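/- Equip $\mathbb{R}^{2n}$, with coordinates $(x_1,\dots,x_n,\xi_1,\dots,\xi_n)$, with the symplectic form $\omega=\sum_i dx_i\wedge d\xi_i$; the Hamiltonian vector field $X_f$ of a smooth function $f$ is given by $\omega(X_f,\cdot)=df$, and $\{f,g\}=\omega(X_f,X_g)$. Let $h=(h_1,\dots,h_n):\mathbb{R}^{2n}\to\mathbb{R}^n$ be a smooth map with $\{h_i,h_j\}=0$ for all $i,j$, and suppose that each $h_i$ is homogeneous: there is an integer $k_i\ge 0$ with $h_i(tx)=t^{k_i}h_i(x)$ for all $t\in\mathbb{R}$ and $x\in\mathbb{R}^{2n}$. Let $\psi:(\mathbb{R}^{2n},0)\to(\mathbb{R}^{2n},0)$ be a local symplectomorphism (a smooth symplectic diffeomorphism between open neighbourhoods of $0$ with $\psi(0)=0$) such that $h\circ\psi=h$ near $0$. Let $\psi^{(1)}=d\psi(0)$ be its linear part. Let $\mathfrak{g}$ be the set of germs at $0$ of Hamiltonian vector fields $X$ that vanish at $0$ and are tangent to the fibration given by $h$, that is, $dh_i(X)=0$ near $0$ for every $i$. Then: 1. $\psi^{(1)}$ is a symplectomorphism of $\mathbb{R}^{2n}$,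 and $h\circ\psi^{(1)}=h$. 2. If moreover $dh_1,\dots,dh_n$ are linearly independent at almost every point of $\mathbb{R}^{2n}$, then there is a vector field in $\mathfrak{g}$ whose time-1 map is $\psi^{(1)}\circ\psi^{-1}$, as germs at $0$. 3. For each $X\in\mathfrak{g}$ whose time-1 map is $\psi^{(1)}\circ\psi^{-1}$ as germs at $0$, there is a unique germ at $0$ of a smooth function $\Psi:(\mathbb{R}^{2n},0)\to\mathbb{R}$ with $\Psi(0)=0$ and $X=X_\Psi$. -/

import Mathlib

open Set Filter Topology MeasureTheory
open scoped ContDiff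

noncomputable section

namespace SymplecticGerm

/-- The space `ℝ²ⁿ`; the coordinates `Sum.inl i` are the positions `x_i`, the coordinates
`Sum.inr i` are the momenta `ξ_i`. -/
abbrev PhaseSpace (n : ℕ) : Type := Fin n ⊕ Fin n → ℝ

/-- The standard symplectic form `ω = ∑ dx_i ∧ dξ_i` (a constant form, evaluated on two tangent
vectors). -/
def omega {n : ℕ} (u v : PhaseSpace n) : ℝ :=
  ∑ i, (u (Sum.inl i) * v (Sum.inr i) - u (Sum.inr i) * v (Sum.inl i))

/-- The Hamiltonian vector field `X_f = ∑ (∂f/∂ξ_i) ∂/∂x_i - (∂f/∂x_i) ∂/∂ξ_i`. -/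
def hamVF {n : ℕ} (f : PhaseSpace n → ℝ) (x : PhaseSpace n) : PhaseSpace n :=
  Sum.elim (fun i => fderiv ℝ f x (Pi.single (Sum.inr i) 1))
    (fun i => -fderiv ℝ f x (Pi.single (Sum.inl i) 1))

/-- The Hamiltonian vector field satisfies `ω(X_f, ·) = df`. -/
theorem omega_hamVF {n : ℕ} (f : PhaseSpace n → ℝ) (x v : PhaseSpace n) :
    omega (hamVF f x) v = fderiv ℝ f x v := by
  have hv : v = ∑ j, v j • (Pi.single j (1 : ℝ) : PhaseSpace n) := by
    ext k
    simp [Finset.sum_apply, Pi.single_apply]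
  conv_rhs => rw [hv]
  rw [map_sum, Fintype.sum_sum_type, ← Finset.sum_add_distrib]
  refine Finset.sum_congr rfl fun i _ => ?_
  simp only [hamVF, Sum.elim_inl, Sum.elim_inr, map_smul, smul_eq_mul]
  ring

/-- The Poisson bracket `{f, g} = ω(X_f, X_g)`. -/
def poissonBracket {n : ℕ} (f g : PhaseSpace n → ℝ) (x : PhaseSpace n) : ℝ :=
  omega (hamVF f x) (hamVF g x)

/-- A linear map `A` preserves `ω`. -/
def PreservesOmega {n : ℕ} (A : PhaseSpace n →L[ℝ] PhaseSpace n) : Prop :=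
  ∀ u v, omega (A u) (A v) = omega u v

/-- A (global) symplectomorphism of `ℝ²ⁿ`: a smooth diffeomorphism `φ` with `φ^* ω = ω`. -/
def IsSymplectomorphism {n : ℕ} (φ : PhaseSpace n → PhaseSpace n) : Prop :=
  ContDiff ℝ ∞ φ ∧
  (∃ χ : PhaseSpace n → PhaseSpace n,
    ContDiff ℝ ∞ χ ∧ Function.LeftInverse χ φ ∧ Function.RightInverse χ φ) ∧
  ∀ x, PreservesOmega (fderiv ℝ φ x)

/-- A local symplectomorphism `ψ : (ℝ²ⁿ, 0) → (ℝ²ⁿ, 0)`: a smooth diffeomorphism from an open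
neighbourhood `ψ.source` of `0` onto an open set `ψ.target`, which fixes `0` and satisfies
`ψ^* ω = ω`. -/
structure IsLocalSymplectomorphism {n : ℕ}
    (ψ : OpenPartialHomeomorph (PhaseSpace n) (PhaseSpace n)) : Prop where
  zero_mem : (0 : PhaseSpace n) ∈ ψ.source
  map_zero : ψ 0 = 0
  contDiffOn : ContDiffOn ℝ ∞ ψ ψ.source
  contDiffOn_symm : ContDiffOn ℝ ∞ ψ.symm ψ.target
  preserves : ∀ x ∈ ψ.source, PreservesOmega (fderiv ℝ ψ x)

/-- The linear part `ψ^{(1)}` at the origin. -/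
def linearPart {n : ℕ} (ψ : PhaseSpace n → PhaseSpace n) : PhaseSpace n →L[ℝ] PhaseSpace n :=
  fderiv ℝ ψ 0

/-- The function `f` is smooth on some neighbourhood of `0`. -/
def SmoothNearZero {n : ℕ} (f : PhaseSpace n → ℝ) : Prop :=
  ∃ U ∈ 𝓝 (0 : PhaseSpace n), ContDiffOn ℝ ∞ f U

/-- The germ at `0` of the vector field `X` lies in the Lie algebra `𝔤` of germs of Hamiltonian
vector fields which vanish at the origin and are tangent to the fibration given by `h`. -/
structure MemLieAlg {n : ℕ} (h : Fin n → PhaseSpace n → ℝ)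
    (X : PhaseSpace n → PhaseSpace n) : Prop where
  hamiltonian : ∃ H : PhaseSpace n → ℝ, SmoothNearZero H ∧ X =ᶠ[𝓝 0] hamVF H
  zero : X 0 = 0
  tangent : ∀ᶠ x in 𝓝 (0 : PhaseSpace n), ∀ i, fderiv ℝ (h i) x (X x) = 0

/-- The germ at `0` of `φ` is the time-1 map of the germ at `0` of the vector field `X`: for every
neighbourhood `U` of `0` and all `x` close enough to `0`, an integral curve of `X` which stays in
`U` during the time interval `[0, 1]` goes from `x` to `φ x`. The clause about `U` makes the notion
depend only on the germs of `X` and `φ`. -/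
def IsTimeOneMap {n : ℕ} (X φ : PhaseSpace n → PhaseSpace n) : Prop :=
  ∀ U ∈ 𝓝 (0 : PhaseSpace n), ∀ᶠ x in 𝓝 (0 : PhaseSpace n),
    ∃ γ : ℝ → PhaseSpace n, γ 0 = x ∧ γ 1 = φ x ∧ (∀ t ∈ Icc (0 : ℝ) 1, γ t ∈ U) ∧
      IsIntegralCurveOn γ (fun _ => X) (Icc 0 1)

/-- The local function `Ψ` is smooth near `0`, vanishes at `0` and has Hamiltonian vector field
`X_Ψ = X` near `0`. -/
structure IsNormalizedHamiltonian {n : ℕ} (X : PhaseSpace n → PhaseSpace n)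
    (Ψ : PhaseSpace n → ℝ) : Prop where
  smooth : SmoothNearZero Ψ
  zero : Ψ 0 = 0
  eq_hamVF : X =ᶠ[𝓝 0] hamVF Ψ

end SymplecticGerm

end

/-! Since `h i` is homogeneous, `h i (t⁻¹ • ψ (t • x)) = h i x` for small `t ≠ 0`; letting `t → 0`
shows that the linear part preserves `h`. Two Hamiltonians of one germ have the same differential,
so they differ by a constant on a ball.

The substance is the vector field. Put `χ = ψ⁽¹⁾ ∘ ψ⁻¹`, which is symplectic, preserves `h` and is
tangent to the identity. The curves `χ(t x) / t` join `x` to `χ x` and follow the field `G t y = Y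
(t y) / t ^ 2`, where `Y = χ_* E - E` and `E` is the Euler field (`exists_isotopy`). `Y` is
symplectic because `E` scales `ω` by a constant and `χ` preserves `ω`; it is tangent to the fibres
by Euler's identity (`exists_radial_defect`). Both properties pass to `G t` and to its primitive in
time `Z t`.

Where the `dh_i` are independent their common kernel is Lagrangian, so `ω(Z t, G t) = 0` there, and
everywhere nearby by density. Orthogonal symplectic fields commute, so `Z t` commutes with `G t`.
Hence the flow of `G` up to time 1 is the time-1 flow of the autonomous field `Z 1`
(`exists_isIntegralCurveOn_of_commute`), which is Hamiltonian by the Poincaré lemma. -/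

/-! ### Smooth dependence of integrals on parameters -/

section ParametricIntegral

universe u

variable {E G : Type u} [NormedAddCommGroup E] [NormedSpace ℝ E] [FiniteDimensional ℝ E]
  [NormedAddCommGroup G] [NormedSpace ℝ G]

/-- Differentiation under the integral sign for a jointly `C¹` integrand. -/
theorem hasFDerivAt_intervalIntegral_of_contDiff {F : E → ℝ → G}
    (hF : ContDiff ℝ 1 (fun p : E × ℝ => F p.1 p.2)) (a b : ℝ) (x₀ : E) :
    HasFDerivAt (fun x => ∫ r in a..b, F x r)
      (∫ r in a..b, fderiv ℝ (fun x => F x r) x₀) x₀ := by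
  have : ProperSpace E := FiniteDimensional.proper ℝ E
  have hD : Continuous (fun p : E × ℝ => fderiv ℝ (fun x => F x p.2) p.1) := by
    have h1 : ContDiff ℝ 1 (Function.uncurry fun (p : E × ℝ) (x : E) => F x p.2) :=
      hF.comp (contDiff_snd.prodMk (contDiff_snd.comp contDiff_fst))
    exact Continuous.fderiv_one h1 continuous_fst
  obtain ⟨C, hC⟩ := ((isCompact_closedBall x₀ 1).prod
    (isCompact_uIcc (a := a) (b := b))).exists_bound_of_continuousOn hD.continuousOn
  have hFc : ∀ x, Continuous (F x) := fun x => hF.continuous.comp (Continuous.prodMk_right x)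
  refine intervalIntegral.hasFDerivAt_integral_of_dominated_of_fderiv_le
    (F := F) (F' := fun x r => fderiv ℝ (fun x => F x r) x) (bound := fun _ => C)
    (Metric.closedBall_mem_nhds x₀ one_pos)
    (Eventually.of_forall fun x => (hFc x).aestronglyMeasurable)
    ((hFc x₀).intervalIntegrable _ _)
    (hD.comp (Continuous.prodMk_right x₀)).aestronglyMeasurable
    (Eventually.of_forall fun t ht x hx => hC (x, t) ⟨hx, uIoc_subset_uIcc ht⟩)
    intervalIntegrable_const
    (Eventually.of_forall fun t _ x _ => ?_)
  have : Differentiable ℝ (fun x => F x t) :=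
    (hF.comp (contDiff_id.prodMk contDiff_const)).differentiable one_ne_zero
  exact (this x).hasFDerivAt

end ParametricIntegral

section ParametricIntegralSmooth

universe u

variable {E : Type u} [NormedAddCommGroup E] [NormedSpace ℝ E] [FiniteDimensional ℝ E]

/-- The derivative of the integral is an integral with values in `E →L[ℝ] G`. So the induction must
quantify over `G`, and a common universe keeps that space admissible. -/
theorem contDiff_intervalIntegral_nat (a b : ℝ) (n : ℕ) :
    ∀ {G : Type u} [NormedAddCommGroup G] [NormedSpace ℝ G] {F : E → ℝ → G},
      ContDiff ℝ n (fun p : E × ℝ => F p.1 p.2) →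
      ContDiff ℝ n (fun x => ∫ r in a..b, F x r) := by
  induction n with
  | zero =>
    intro G _ _ F hF
    rw [Nat.cast_zero, contDiff_zero] at hF ⊢
    exact intervalIntegral.continuous_parametric_intervalIntegral_of_continuous' hF a b
  | succ n ih =>
    intro G _ _ F hF
    rw [Nat.cast_add, Nat.cast_one] at hF
    refine contDiff_succ_iff_hasFDerivAt.2
      ⟨fun x => ∫ r in a..b, fderiv ℝ (fun y => F y r) x, ih ?_, fun x =>
        hasFDerivAt_intervalIntegral_of_contDiff (hF.of_le (by simp)) a b x⟩
    have h1 : ContDiff ℝ (n + 1) (Function.uncurry fun (p : E × ℝ) (x : E) => F x p.2) :=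
      hF.comp (contDiff_snd.prodMk (contDiff_snd.comp contDiff_fst))
    exact ContDiff.fderiv h1 contDiff_fst le_rfl

/-- An integral over a compact interval depends smoothly on the parameters of its integrand. -/
theorem contDiff_intervalIntegral {G : Type u} [NormedAddCommGroup G] [NormedSpace ℝ G]
    {F : E → ℝ → G} (hF : ContDiff ℝ ∞ (fun p : E × ℝ => F p.1 p.2)) (a b : ℝ) :
    ContDiff ℝ ∞ (fun x => ∫ r in a..b, F x r) :=
  contDiff_infty.2 fun n => contDiff_intervalIntegral_nat a b n (contDiff_infty.1 hF n)

end ParametricIntegralSmooth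

/-! ### Hadamard's lemma, primitives in time, extension of germs -/

section Hadamard

variable {E G : Type} [NormedAddCommGroup E] [NormedSpace ℝ E] [FiniteDimensional ℝ E]
  [NormedAddCommGroup G] [NormedSpace ℝ G]

/-- **Hadamard's lemma**: a smooth function which vanishes at time `0` is divisible by the time. -/
theorem exists_contDiff_eq_smul [CompleteSpace G] {F : ℝ → E → G}
    (hF : ContDiff ℝ ∞ (fun p : ℝ × E => F p.1 p.2)) (h0 : ∀ y, F 0 y = 0) :
    ∃ F₁ : ℝ → E → G, ContDiff ℝ ∞ (fun p : ℝ × E => F₁ p.1 p.2) ∧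
      ∀ t y, F t y = t • F₁ t y := by
  set Φ : ℝ × E → G := fun p => F p.1 p.2
  have hD : ContDiff ℝ ∞ (fun p : ℝ × E => fderiv ℝ Φ p (1, 0)) :=
    (hF.fderiv_right (m := ∞) (by simp)).clm_apply contDiff_const
  refine ⟨fun t y => ∫ r in (0 : ℝ)..1, fderiv ℝ Φ (r * t, y) (1, 0), ?_, fun t y => ?_⟩
  · refine contDiff_intervalIntegral (F := fun (p : ℝ × E) r => fderiv ℝ Φ (r * p.1, p.2) (1, 0))
      ?_ 0 1
    exact hD.comp ((contDiff_snd.mul (contDiff_fst.comp contDiff_fst)).prodMk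
      (contDiff_snd.comp contDiff_fst))
  · have hd : ∀ r ∈ uIcc (0 : ℝ) 1, HasDerivAt (fun r : ℝ => Φ (r * t, y))
        (t • fderiv ℝ Φ (r * t, y) (1, 0)) r := by
      intro r _
      have h1 : HasDerivAt (fun r : ℝ => (r * t, y)) (t, (0 : E)) r :=
        (by simpa using (hasDerivAt_id r).mul_const t : HasDerivAt (fun r : ℝ => r * t) t r).prodMk
          (hasDerivAt_const r y)
      have h2 := ((hF.differentiable (by simp)) (r * t, y)).hasFDerivAt.comp_hasDerivAt r h1
      have h3 : ((t, 0) : ℝ × E) = t • ((1, 0) : ℝ × E) := by simp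
      rw [h3, map_smul] at h2
      exact h2
    have hc : Continuous fun r : ℝ => fderiv ℝ Φ (r * t, y) (1, 0) :=
      hD.continuous.comp (by fun_prop)
    have := intervalIntegral.integral_eq_sub_of_hasDerivAt hd
      ((continuous_const.smul hc).intervalIntegrable _ _)
    rw [intervalIntegral.integral_smul] at this
    simp only [one_mul, zero_mul] at this
    rw [this]
    simp [Φ, h0]

/-- The integral over `[0, t]` of a smooth time-dependent function is smooth in the time and the
parameter. -/
theorem contDiff_primitive {F : ℝ → E → G}
    (hF : ContDiff ℝ ∞ (fun p : ℝ × E => F p.1 p.2)) :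
    ContDiff ℝ ∞ (fun p : ℝ × E => ∫ τ in (0 : ℝ)..p.1, F τ p.2) := by
  -- The substitution `τ = t r` gives fixed limits of integration.
  have h1 : (fun p : ℝ × E => ∫ τ in (0 : ℝ)..p.1, F τ p.2) =
      fun p : ℝ × E => p.1 • ∫ r in (0 : ℝ)..1, F (p.1 * r) p.2 := by
    funext p
    rw [intervalIntegral.smul_integral_comp_mul_left (fun τ => F τ p.2)]
    simp
  rw [h1]
  refine contDiff_fst.smul (contDiff_intervalIntegral (F := fun (p : ℝ × E) r => F (p.1 * r) p.2)
    ?_ 0 1)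
  exact hF.comp (((contDiff_fst.comp contDiff_fst).mul contDiff_snd).prodMk
    (contDiff_snd.comp contDiff_fst))

/-- A germ of smooth functions extends to a globally defined smooth function. -/
theorem exists_contDiff_eventuallyEq {f : E → G} {x : E} {U : Set E} (hU : U ∈ 𝓝 x)
    (hf : ContDiffOn ℝ ∞ f U) : ∃ g : E → G, ContDiff ℝ ∞ g ∧ g =ᶠ[𝓝 x] f := by
  obtain ⟨V, hVU, hV, hxV⟩ := mem_nhds_iff.1 hU
  obtain ⟨r, hr, hrV⟩ := Metric.isOpen_iff.1 hV x hxV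
  let b : ContDiffBump x := ⟨r / 4, r / 2, by positivity, by linarith⟩
  refine ⟨fun y => b y • f y, contDiff_iff_contDiffAt.2 fun y => ?_, ?_⟩
  · by_cases hy : y ∈ V
    · exact b.contDiff.contDiffAt.smul (hf.contDiffAt (mem_of_superset (hV.mem_nhds hy) hVU))
    -- The bump is supported in the closed ball of radius `r / 2`, inside `V`, so the product
    -- vanishes near points outside `V`.
    · have hy' : y ∈ (tsupport b)ᶜ := by
        rw [b.tsupport_eq]
        intro hy'
        exact hy (hrV (Metric.closedBall_subset_ball (by simp [b]; linarith) hy'))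
      refine (contDiffAt_const (c := (0 : G))).congr_of_eventuallyEq ?_
      filter_upwards [(isClosed_tsupport b).isOpen_compl.mem_nhds hy'] with z hz
      simp [image_eq_zero_of_notMem_tsupport hz]
  · filter_upwards [b.eventuallyEq_one] with y hy
    simp [hy]

end Hadamard

/-! ### Flows of commuting time-dependent fields -/

section CommutingFlows

variable {E F : Type*} [NormedAddCommGroup E] [NormedSpace ℝ E]
  [NormedAddCommGroup F] [NormedSpace ℝ F]

/-- First order Taylor estimate from a bound on the second derivative. -/
theorem Convex.norm_taylor_one_le {f : E → F} (hf : ContDiff ℝ 2 f) {S : Set E} (hS : Convex ℝ S)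
    {M : ℝ} (hM : ∀ y ∈ S, ‖fderiv ℝ (fderiv ℝ f) y‖ ≤ M) {y z : E} (hy : y ∈ S) (hz : z ∈ S) :
    ‖f z - f y - fderiv ℝ f y (z - y)‖ ≤ M * ‖z - y‖ ^ 2 := by
  have hM0 : 0 ≤ M := le_trans (norm_nonneg (fderiv ℝ (fderiv ℝ f) y)) (hM y hy)
  have hd : Differentiable ℝ f := hf.differentiable (by simp)
  have hd' : Differentiable ℝ (fderiv ℝ f) :=
    (hf.fderiv_right (m := 1) (by norm_num)).differentiable (by simp)
  have hseg : segment ℝ y z ⊆ S := hS.segment_subset hy hz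
  -- The mean value inequality is used twice: on `f - Df(y)`, and on `Df` to bound its variation
  -- along the segment.
  have key := (convex_segment y z).norm_image_sub_le_of_norm_fderiv_le' (f := f)
    (φ := fderiv ℝ f y) (C := M * ‖z - y‖) (fun w _ => hd w) (fun w hw => ?_)
    (left_mem_segment ℝ y z) (right_mem_segment ℝ y z)
  · rw [pow_two, ← mul_assoc]; exact key
  · refine (hS.norm_image_sub_le_of_norm_fderiv_le (f := fderiv ℝ f) (fun w _ => hd' w) hM hy
      (hseg hw)).trans ?_
    gcongr
    obtain ⟨θ, hθ, rfl⟩ := (segment_eq_image' ℝ y z).subset hw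
    simp only [add_sub_cancel_left, norm_smul, Real.norm_eq_abs, abs_of_nonneg hθ.1]
    exact mul_le_of_le_one_left (norm_nonneg _) hθ.2

/-- **Picard-Lindelöf** on `[0, 1]`, with solutions which stay in the ball. -/
theorem exists_solution_mem_closedBall [CompleteSpace E] {v : ℝ → E → E} {a : ℝ} (ha : 0 ≤ a)
    (hv0 : ∀ t ∈ Icc (0 : ℝ) 1, v t 0 = 0)
    (hlip : ∀ t ∈ Icc (0 : ℝ) 1, LipschitzOnWith (1 / 2) (v t) (Metric.closedBall 0 a))
    (hcont : ∀ y, Continuous fun t => v t y) {x : E} (hx : x ∈ Metric.closedBall (0 : E) (a / 2)) :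
    ∃ u : ℝ → E, u 0 = x ∧ (∀ t ∈ Icc (0 : ℝ) 1, u t ∈ Metric.closedBall (0 : E) a) ∧
      ∀ t ∈ Icc (0 : ℝ) 1, HasDerivWithinAt u (v t (u t)) (Icc 0 1) t := by
  let t₀ : Icc (0 : ℝ) 1 := ⟨0, by simp⟩
  let A : NNReal := ⟨a, ha⟩
  have hA : (A : ℝ) = a := rfl
  -- As `v t 0 = 0`, the speed is at most `a / 2` on the ball, so in unit time a curve from the half
  -- ball cannot leave it.
  have hf : IsPicardLindelof v t₀ 0 A (A / 2) (A / 2) (1 / 2) := by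
    refine ⟨hlip, fun y _ => (hcont y).continuousOn, fun t ht y hy => ?_, ?_⟩
    · have h1 := (hlip t ht).dist_le_mul y hy 0 (by simpa using ha)
      have h2 : ‖y‖ ≤ a := mem_closedBall_zero_iff.1 hy
      rw [hv0 t ht, dist_zero_right, dist_zero_right] at h1
      push_cast at h1 ⊢
      rw [hA]
      linarith
    · simp [t₀, hA]
      linarith
  have hx' : x ∈ Metric.closedBall (0 : E) ((A / 2 : NNReal) : ℝ) := by
    simpa [hA] using hx
  obtain ⟨α, hα⟩ := ODE.FunSpace.exists_isFixedPt_next hf hx'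
  have hmem : ∀ t, α.compProj t ∈ Metric.closedBall (0 : E) a :=
    fun t => α.compProj_mem_closedBall hf.mul_max_le
  refine ⟨α.compProj, ?_, fun t _ => hmem t, fun t ht => ?_⟩
  · have : α.compProj (t₀ : ℝ) = x := by
      rw [ODE.FunSpace.compProj_val, ← hα, ODE.FunSpace.next_apply₀]
    exact this
  · apply (ODE.hasDerivWithinAt_picard_Icc t₀.2 hf.continuousOn_uncurry
      α.continuous_compProj.continuousOn (fun _ _ => α.compProj_mem_closedBall hf.mul_max_le)
      x ht).congr_of_mem _ ht
    intro t' ht'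
    nth_rw 1 [← hα]
    rw [ODE.FunSpace.compProj_of_mem ht', ODE.FunSpace.next_apply]

/-- Let `G` be a time-dependent vector field whose primitive `Z` in time commutes with `G` at each
time. Then the time-1 map of the time-dependent field `G` is the time-1 map of the autonomous field
`Z 1`. -/
theorem exists_isIntegralCurveOn_of_commute [FiniteDimensional ℝ E] {G Z : ℝ → E → E}
    (hG : ContDiff ℝ ∞ (fun p : ℝ × E => G p.1 p.2))
    (hZ : ContDiff ℝ ∞ (fun p : ℝ × E => Z p.1 p.2)) {a : ℝ} (ha : 0 < a)
    (hG0 : ∀ t ∈ Icc (0 : ℝ) 1, G t 0 = 0)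
    (hG1 : ∀ t ∈ Icc (0 : ℝ) 1, ∀ y ∈ Metric.closedBall (0 : E) (2 * a),
      ‖fderiv ℝ (G t) y‖ ≤ 1 / 2)
    (hZ0 : ∀ y, Z 0 y = 0) (hZG : ∀ t y, HasDerivAt (fun τ => Z τ y) (G t y) t)
    (hcomm : ∀ t ∈ Icc (0 : ℝ) 1, ∀ y ∈ Metric.closedBall (0 : E) a,
      fderiv ℝ (Z t) y (G t y) = fderiv ℝ (G t) y (Z t y))
    {R : ℝ → E} (hR0 : R 0 ∈ Metric.closedBall (0 : E) (a / 2))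
    (hRc : ContinuousOn R (Icc 0 1))
    (hR : ∀ t ∈ Ico (0 : ℝ) 1, HasDerivWithinAt R (G t (R t)) (Ici t) t)
    (hRa : ∀ t ∈ Icc (0 : ℝ) 1, R t ∈ Metric.closedBall (0 : E) a) :
    ∃ γ : ℝ → E, γ 0 = R 0 ∧ γ 1 = R 1 ∧
      (∀ s ∈ Icc (0 : ℝ) 1, γ s ∈ Metric.closedBall (0 : E) a) ∧
      IsIntegralCurveOn γ (fun _ => Z 1) (Icc 0 1) := by
  have : ProperSpace E := FiniteDimensional.proper ℝ E
  have hsub : Metric.closedBall (0 : E) a ⊆ Metric.closedBall 0 (2 * a) :=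
    Metric.closedBall_subset_closedBall (by linarith)
  have hGt : ∀ t, ContDiff ℝ ∞ (G t) := fun t => hG.comp (contDiff_const.prodMk contDiff_id)
  have hGd : ∀ t, Differentiable ℝ (G t) := fun t => (hGt t).differentiable (by simp)
  have hGlip : ∀ t ∈ Icc (0 : ℝ) 1,
      LipschitzOnWith (1 / 2) (G t) (Metric.closedBall 0 (2 * a)) := fun t ht =>
    (convex_closedBall _ _).lipschitzOnWith_of_nnnorm_fderiv_le (fun y _ => hGd t y) fun y hy => by
      have := hG1 t ht y hy
      exact_mod_cast this
  have hsGlip : ∀ s ∈ Icc (0 : ℝ) 1, ∀ t ∈ Icc (0 : ℝ) 1,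
      LipschitzOnWith (1 / 2) (fun y => s • G t y) (Metric.closedBall 0 (2 * a)) := by
    intro s hs t ht
    refine LipschitzOnWith.of_dist_le_mul fun y hy z hz => ?_
    rw [dist_smul₀, Real.norm_eq_abs, abs_of_nonneg hs.1]
    have h1 := (hGlip t ht).dist_le_mul y hy z hz
    exact (mul_le_of_le_one_left dist_nonneg hs.2).trans h1
  have hGcont : ∀ y, Continuous fun t => G t y := fun y =>
    hG.continuous.comp (Continuous.prodMk_left y)
  -- `u s` solves the equation of `s • G`. By commutation, `u s t` should be the time-`s` flow of `Z
  -- t` from `R 0`, so `s ↦ u s 1` is the curve sought.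
  have hexists : ∀ s : ℝ, s ∈ Icc (0 : ℝ) 1 → ∃ u : ℝ → E, u 0 = R 0 ∧
      (∀ t ∈ Icc (0 : ℝ) 1, u t ∈ Metric.closedBall (0 : E) a) ∧
      ∀ t ∈ Icc (0 : ℝ) 1, HasDerivWithinAt u (s • G t (u t)) (Icc 0 1) t := fun s hs =>
    exists_solution_mem_closedBall (v := fun t y => s • G t y) ha.le
      (fun t ht => by simp [hG0 t ht]) (fun t ht => (hsGlip s hs t ht).mono hsub)
      (fun y => (hGcont y).const_smul s) hR0
  choose! u hu0 hua hu using hexists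
  have huc : ∀ s ∈ Icc (0 : ℝ) 1, ContinuousOn (u s) (Icc 0 1) := fun s hs t ht =>
    (hu s hs t ht).continuousWithinAt
  have toIci : ∀ {f : ℝ → E} {f' : E} {t : ℝ}, t ∈ Ico (0 : ℝ) 1 →
      HasDerivWithinAt f f' (Icc 0 1) t → HasDerivWithinAt f f' (Ici t) t := by
    intro f f' t ht hf
    exact (hf.mono (Icc_subset_Icc_left ht.1)).mono_of_mem_nhdsWithin
      (Icc_mem_nhdsGE ht.2)
  have hzero : (0 : ℝ) ∈ Icc (0 : ℝ) 1 := by simp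
  have hone : (1 : ℝ) ∈ Icc (0 : ℝ) 1 := by simp
  -- bound on the primitive
  have hZa : ∀ t ∈ Icc (0 : ℝ) 1, ∀ y ∈ Metric.closedBall (0 : E) a, ‖Z t y‖ ≤ a := by
    intro t ht y hy
    have hGy : ∀ τ ∈ Ico (0 : ℝ) 1, ‖G τ y‖ ≤ a := by
      intro τ hτ
      have h1 := (hGlip τ ⟨hτ.1, hτ.2.le⟩).dist_le_mul y (hsub hy) 0 (by simp; linarith)
      have h2 : ‖y‖ ≤ a := by simpa using hy
      rw [hG0 τ ⟨hτ.1, hτ.2.le⟩, dist_zero_right, dist_zero_right] at h1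
      push_cast at h1
      linarith
    have := norm_image_sub_le_of_norm_deriv_le_segment' (f := fun τ => Z τ y)
      (fun τ _ => (hZG τ y).hasDerivWithinAt) hGy t ht
    simp only [hZ0, sub_zero] at this
    exact this.trans (mul_le_of_le_one_right ha.le ht.2)
  -- bound on the second derivative
  obtain ⟨M, hM⟩ : ∃ M : ℝ, ∀ t ∈ Icc (0 : ℝ) 1, ∀ y ∈ Metric.closedBall (0 : E) (2 * a),
      ‖fderiv ℝ (fderiv ℝ (G t)) y‖ ≤ M := by
    have h1 : ContDiff ℝ ∞ (fun p : ℝ × E => fderiv ℝ (G p.1) p.2) :=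
      ContDiff.fderiv (f := fun (p : ℝ × E) y => G p.1 y) (n := ∞)
        (hG.comp ((contDiff_fst.comp contDiff_fst).prodMk contDiff_snd)) contDiff_snd (by simp)
    have h2 : ContDiff ℝ ∞ (fun p : ℝ × E => fderiv ℝ (fderiv ℝ (G p.1)) p.2) :=
      ContDiff.fderiv (f := fun (p : ℝ × E) y => fderiv ℝ (G p.1) y) (n := ∞)
        (h1.comp ((contDiff_fst.comp contDiff_fst).prodMk contDiff_snd)) contDiff_snd (by simp)
    obtain ⟨M, hM⟩ := ((isCompact_Icc (a := (0 : ℝ)) (b := 1)).prod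
      (isCompact_closedBall (0 : E) (2 * a))).exists_bound_of_continuousOn h2.continuous.continuousOn
    exact ⟨M, fun t ht y hy => hM (t, y) ⟨ht, hy⟩⟩
  have hM0 : 0 ≤ M := (norm_nonneg _).trans (hM 0 hzero 0 (by simp; linarith))
  -- `M * a ^ 2` comes from the Taylor remainder, `a / 2` from `‖DG(Z)‖`.
  set C : ℝ := M * a ^ 2 + a / 2 with hC
  -- the two-parameter estimate
  have key : ∀ s ∈ Icc (0 : ℝ) 1, ∀ s' ∈ Icc (0 : ℝ) 1,
      ‖u s' 1 - u s 1 - (s' - s) • Z 1 (u s 1)‖ ≤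
        C * 2 * (Real.exp (1 / 2) - 1) * ‖s' - s‖ ^ 2 := by
    intro s hs s' hs'
    set δ := s' - s with hδ
    have hδ1 : |δ| ≤ 1 := by
      rw [abs_le]; constructor <;> linarith [hs.1, hs.2, hs'.1, hs'.2]
    -- The trial curve `u s + δ • Z t (u s)` is the first-order prediction of `u s'`.
    have hp : ∀ t ∈ Icc (0 : ℝ) 1, HasDerivWithinAt (fun t => u s t + δ • Z t (u s t))
        (s • G t (u s t) + δ • (G t (u s t) + fderiv ℝ (Z t) (u s t) (s • G t (u s t))))
        (Icc 0 1) t := by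
      intro t ht
      have hu' := hu s hs t ht
      have hdZ := (hZ.differentiable (by simp) (t, u s t)).hasFDerivAt
      have h1 := hdZ.comp_hasDerivWithinAt t ((hasDerivWithinAt_id t (Icc 0 1)).prodMk hu')
      have h2 : fderiv ℝ (fun p : ℝ × E => Z p.1 p.2) (t, u s t) (1, 0) = G t (u s t) := by
        have := hdZ.comp_hasDerivAt t ((hasDerivAt_id t).prodMk (hasDerivAt_const t (u s t)))
        exact this.unique (hZG t (u s t))
      have h3 : ∀ w, fderiv ℝ (fun p : ℝ × E => Z p.1 p.2) (t, u s t) (0, w) =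
          fderiv ℝ (Z t) (u s t) w := by
        intro w
        have := HasFDerivAt.comp (u s t) hdZ
          ((hasFDerivAt_const t (u s t)).prodMk (hasFDerivAt_id (u s t)))
        have h5 : fderiv ℝ (Z t) (u s t) = _ := this.fderiv
        rw [h5]
        simp
      have h4 : fderiv ℝ (fun p : ℝ × E => Z p.1 p.2) (t, u s t) (1, s • G t (u s t)) =
          G t (u s t) + fderiv ℝ (Z t) (u s t) (s • G t (u s t)) := by
        rw [← h2, ← h3, ← map_add, h2]; simp
      rw [h4] at h1
      exact hu'.add (h1.const_smul δ)
    -- The trial curve may leave the ball of radius `a`; this is why `G` is controlled on radius `2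
    -- * a`.
    have hpa : ∀ t ∈ Icc (0 : ℝ) 1, u s t + δ • Z t (u s t) ∈ Metric.closedBall (0 : E) (2 * a) := by
      intro t ht
      have h1 := hua s hs t ht
      have h2 := hZa t ht _ h1
      rw [mem_closedBall_zero_iff] at h1 ⊢
      refine (norm_add_le _ _).trans ?_
      rw [norm_smul, Real.norm_eq_abs]
      nlinarith [norm_nonneg (Z t (u s t)), abs_nonneg δ]
    have hbound : ∀ t ∈ Ico (0 : ℝ) 1,
        dist (s • G t (u s t) + δ • (G t (u s t) + fderiv ℝ (Z t) (u s t) (s • G t (u s t))))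
          (s' • G t (u s t + δ • Z t (u s t))) ≤ C * δ ^ 2 := by
      intro t ht
      have ht' : t ∈ Icc (0 : ℝ) 1 := ⟨ht.1, ht.2.le⟩
      have h1 := hua s hs t ht'
      have h2 := hZa t ht' _ h1
      have h3 := (convex_closedBall (0 : E) (2 * a)).norm_taylor_one_le
        (contDiff_infty.1 (hGt t) 2) (hM t ht') (hsub h1) (hpa t ht')
      set U := u s t
      set W := Z t U
      rw [add_sub_cancel_left, norm_smul, mul_pow, Real.norm_eq_abs, sq_abs] at h3
      rw [dist_eq_norm, map_smul, hcomm t ht' U h1]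
      -- After `hcomm` the terms of first order in `δ` cancel; a Taylor remainder and a `δ ^ 2` term
      -- are left.
      have h4 : s • G t U + δ • (G t U + s • fderiv ℝ (G t) U W) - s' • G t (U + δ • W) =
          -(s' • (G t (U + δ • W) - G t U - fderiv ℝ (G t) U (δ • W))) -
            (δ ^ 2) • fderiv ℝ (G t) U W := by
        rw [map_smul, hδ]
        module
      rw [h4]
      refine (norm_sub_le _ _).trans ?_
      rw [norm_neg, norm_smul, norm_smul, Real.norm_eq_abs, abs_of_nonneg hs'.1, norm_pow,
        Real.norm_eq_abs, sq_abs]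
      have h5 : ‖fderiv ℝ (G t) U W‖ ≤ a / 2 := by
        refine (ContinuousLinearMap.le_opNorm _ _).trans ?_
        have := hG1 t ht' U (hsub h1)
        nlinarith [norm_nonneg W, norm_nonneg (fderiv ℝ (G t) U)]
      have h6 : ‖W‖ ^ 2 ≤ a ^ 2 := by gcongr
      have h7 := mul_le_of_le_one_left (norm_nonneg
        (G t (U + δ • W) - G t U - fderiv ℝ (G t) U (δ • W))) hs'.2
      have h8 : M * (δ ^ 2 * ‖W‖ ^ 2) ≤ M * (δ ^ 2 * a ^ 2) := by gcongr
      have h9 : δ ^ 2 * ‖fderiv ℝ (G t) U W‖ ≤ δ ^ 2 * (a / 2) := by gcongr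
      rw [hC]
      linarith
    -- Grönwall compares the trial curve with the exact solution `u s'`; they start together because
    -- `Z 0 = 0`.
    have hgr := dist_le_of_approx_trajectories_ODE_of_mem (a := 0) (b := 1) (K := 1 / 2) (δ := 0)
      (v := fun t y => s' • G t y) (s := fun _ => Metric.closedBall (0 : E) (2 * a))
      (f := fun t => u s t + δ • Z t (u s t)) (g := u s') (εf := C * δ ^ 2) (εg := 0)
      (g' := fun t => s' • G t (u s' t))
      (fun t ht => hsGlip s' hs' t ⟨ht.1, ht.2.le⟩)
      (fun t ht => (hp t ht).continuousWithinAt)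
      (fun t ht => toIci ht (hp t ⟨ht.1, ht.2.le⟩)) hbound
      (fun t ht => hpa t ⟨ht.1, ht.2.le⟩) (huc s' hs')
      (fun t ht => toIci ht (hu s' hs' t ⟨ht.1, ht.2.le⟩)) (fun t _ => by simp)
      (fun t ht => hsub (hua s' hs' t ⟨ht.1, ht.2.le⟩)) (by simp [hu0 s hs, hu0 s' hs', hZ0]) 1 hone
    rw [gronwallBound_of_K_ne_0 (by norm_num)] at hgr
    rw [dist_comm, dist_eq_norm] at hgr
    rw [Real.norm_eq_abs, sq_abs, sub_sub]
    refine hgr.trans (le_of_eq ?_)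
    push_cast
    simp only [add_zero, sub_zero, mul_one, zero_mul, zero_add]
    ring
  refine ⟨fun s => u s 1, ?_, ?_, fun s hs => hua s hs 1 hone, fun s hs => ?_⟩
  · have := ODE_solution_unique_of_mem_Icc_right (a := 0) (b := 1) (K := 1 / 2)
      (v := fun t y => (0 : ℝ) • G t y) (s := fun _ => Metric.closedBall (0 : E) (2 * a))
      (f := u 0) (g := fun _ => R 0)
      (fun t ht => hsGlip 0 hzero t ⟨ht.1, ht.2.le⟩) (huc 0 hzero)
      (fun t ht => toIci ht (hu 0 hzero t ⟨ht.1, ht.2.le⟩))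
      (fun t ht => hsub (hua 0 hzero t ⟨ht.1, ht.2.le⟩)) continuousOn_const
      (fun t _ => by simpa using hasDerivWithinAt_const t (Ici t) (R 0))
      (fun t _ => hsub (hRa 0 hzero)) (hu0 0 hzero)
    exact this hone
  · have := ODE_solution_unique_of_mem_Icc_right (a := 0) (b := 1) (K := 1 / 2)
      (v := fun t y => (1 : ℝ) • G t y) (s := fun _ => Metric.closedBall (0 : E) (2 * a))
      (f := u 1) (g := R)
      (fun t ht => hsGlip 1 hone t ⟨ht.1, ht.2.le⟩) (huc 1 hone)
      (fun t ht => toIci ht (hu 1 hone t ⟨ht.1, ht.2.le⟩))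
      (fun t ht => hsub (hua 1 hone t ⟨ht.1, ht.2.le⟩)) hRc
      (fun t ht => by simpa using hR t ht)
      (fun t ht => hsub (hRa t ⟨ht.1, ht.2.le⟩)) (hu0 1 hone)
    exact this hone
  · rw [hasDerivWithinAt_iff_isLittleO]
    have h1 : (fun s' => u s' 1 - u s 1 - (s' - s) • Z 1 (u s 1)) =O[𝓝[Icc 0 1] s]
        (fun s' => (s' - s) ^ 2) := by
      refine Asymptotics.IsBigO.of_bound (C * 2 * (Real.exp (1 / 2) - 1)) ?_
      filter_upwards [self_mem_nhdsWithin] with s' hs'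
      rw [norm_pow]
      exact key s hs s' hs'
    refine h1.trans_isLittleO ?_
    have h2 : Tendsto (fun s' => s' - s) (𝓝[Icc 0 1] s) (𝓝 0) := by
      have : Continuous fun s' : ℝ => s' - s := by fun_prop
      simpa using (this.tendsto s).mono_left nhdsWithin_le_nhds
    have := (Asymptotics.isLittleO_pow_id (𝕜 := ℝ) (n := 2) (by norm_num)).comp_tendsto h2
    simpa [Function.comp_def] using this

end CommutingFlows

/-! ### Linear symplectic algebra -/

namespace SymplecticGerm

variable {n : ℕ}

section Form

/-- The symplectic form as a continuous bilinear map. -/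
noncomputable def omegaL (n : ℕ) : PhaseSpace n →L[ℝ] PhaseSpace n →L[ℝ] ℝ :=
  ∑ i : Fin n, ((ContinuousLinearMap.proj (Sum.inl i)).smulRight
      (ContinuousLinearMap.proj (R := ℝ) (φ := fun _ : Fin n ⊕ Fin n => ℝ) (Sum.inr i)) -
    (ContinuousLinearMap.proj (Sum.inr i)).smulRight
      (ContinuousLinearMap.proj (R := ℝ) (φ := fun _ : Fin n ⊕ Fin n => ℝ) (Sum.inl i)))

theorem omegaL_apply (u v : PhaseSpace n) : omegaL n u v = omega u v := by
  simp [omegaL, omega]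

theorem omega_swap (u v : PhaseSpace n) : omega u v = -omega v u := by
  simp only [omega, ← Finset.sum_neg_distrib]
  exact Finset.sum_congr rfl fun i _ => by ring

theorem eq_zero_of_omega_left {u : PhaseSpace n} (h : ∀ v, omega u v = 0) : u = 0 := by
  ext j
  rcases j with i | i
  · simpa [omega, Pi.single_apply] using h (Pi.single (Sum.inr i) 1)
  · simpa [omega, Pi.single_apply] using h (Pi.single (Sum.inl i) 1)

theorem omega_sub_left (u u' v : PhaseSpace n) :
    omega (u - u') v = omega u v - omega u' v := by
  simp [← omegaL_apply]

theorem eq_of_omega_left {u u' : PhaseSpace n} (h : ∀ v, omega u v = omega u' v) : u = u' :=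
  sub_eq_zero.1 (eq_zero_of_omega_left fun v => by rw [omega_sub_left, h, sub_self])

theorem hamVF_eq_iff {f : PhaseSpace n → ℝ} {x u : PhaseSpace n} :
    hamVF f x = u ↔ ∀ v, fderiv ℝ f x v = omega u v :=
  ⟨fun h v => by rw [← omega_hamVF, h], fun h => eq_of_omega_left fun v => by
    rw [omega_hamVF, h]⟩

theorem PreservesOmega.injective {A : PhaseSpace n →L[ℝ] PhaseSpace n} (hA : PreservesOmega A) :
    Function.Injective A := by
  refine (injective_iff_map_eq_zero A).2 fun u hu => eq_zero_of_omega_left fun v => ?_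
  rw [← hA u v, hu]
  simp [omega]

theorem PreservesOmega.surjective {A : PhaseSpace n →L[ℝ] PhaseSpace n} (hA : PreservesOmega A) :
    Function.Surjective A :=
  LinearMap.surjective_of_injective (f := (A : PhaseSpace n →ₗ[ℝ] PhaseSpace n)) hA.injective

/-- The continuous linear equivalence given by a linear map which preserves `ω`. -/
noncomputable def PreservesOmega.equiv {A : PhaseSpace n →L[ℝ] PhaseSpace n} (hA : PreservesOmega A) :
    PhaseSpace n ≃L[ℝ] PhaseSpace n :=
  (LinearEquiv.ofBijective (A : PhaseSpace n →ₗ[ℝ] PhaseSpace n)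
    ⟨hA.injective, hA.surjective⟩).toContinuousLinearEquiv

theorem PreservesOmega.equiv_apply {A : PhaseSpace n →L[ℝ] PhaseSpace n} (hA : PreservesOmega A)
    (x : PhaseSpace n) : hA.equiv x = A x := rfl

theorem PreservesOmega.isSymplectomorphism {A : PhaseSpace n →L[ℝ] PhaseSpace n}
    (hA : PreservesOmega A) : IsSymplectomorphism A := by
  refine ⟨A.contDiff, ⟨hA.equiv.symm, hA.equiv.symm.contDiff, fun x => ?_, fun x => ?_⟩, fun x => ?_⟩
  · rw [← hA.equiv_apply, ContinuousLinearEquiv.symm_apply_apply]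
  · rw [← hA.equiv_apply, ContinuousLinearEquiv.apply_symm_apply]
  · rwa [A.fderiv]

/-- If `dh_1, …, dh_n` are independent at `y` and the `h_i` Poisson commute, then the common kernel
of the `dh_i` at `y` is isotropic. -/
theorem omega_eq_zero_of_tangent {h : Fin n → PhaseSpace n → ℝ} {y : PhaseSpace n}
    (hc : ∀ i j, poissonBracket (h i) (h j) y = 0)
    (hi : LinearIndependent ℝ fun i => fderiv ℝ (h i) y) {v w : PhaseSpace n}
    (hv : ∀ i, fderiv ℝ (h i) y v = 0) (hw : ∀ i, fderiv ℝ (h i) y w = 0) : omega v w = 0 := by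
  set X : Fin n → PhaseSpace n := fun i => hamVF (h i) y
  set α : Fin n → Module.Dual ℝ (PhaseSpace n) := fun i =>
    (fderiv ℝ (h i) y : PhaseSpace n →ₗ[ℝ] ℝ)
  have hα : LinearIndependent ℝ α :=
    hi.map' (ContinuousLinearMap.coeLM ℝ) (LinearMap.ker_eq_bot.2 fun f g hfg => by
      ext1 x
      exact LinearMap.congr_fun hfg x)
  have hX : LinearIndependent ℝ X := by
    refine LinearIndependent.of_comp
      (omegaL n : PhaseSpace n →ₗ[ℝ] (PhaseSpace n →L[ℝ] ℝ)) ?_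
    convert hi using 1
    funext i
    ext1 v
    exact (omegaL_apply _ _).trans (omega_hamVF _ _ _)
  -- Commutation puts the `X_{h_j}` in the common kernel. Both spaces have dimension `n = 2n - n`,
  -- so the `X_{h_j}` span the kernel, and `ω(X_{h_j}, w) = dh_j(w) = 0`.
  have hle : Submodule.span ℝ (range X) ≤ (Submodule.span ℝ (range α)).dualCoannihilator := by
    rw [Submodule.span_le]
    rintro _ ⟨j, rfl⟩
    rw [SetLike.mem_coe, Submodule.mem_dualCoannihilator]
    intro φ hφ
    induction hφ using Submodule.span_induction with
    | mem φ hφ =>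
      obtain ⟨i, rfl⟩ := hφ
      change fderiv ℝ (h i) y (hamVF (h j) y) = 0
      rw [← omega_hamVF]
      exact hc i j
    | zero => rfl
    | add a b _ _ ha hb => simp [ha, hb]
    | smul c a _ ha => simp [ha]
  have hdim := Subspace.finrank_add_finrank_dualCoannihilator_eq (Submodule.span ℝ (range α))
  rw [finrank_span_eq_card hα, Module.finrank_fintype_fun_eq_card, Fintype.card_sum,
    Fintype.card_fin] at hdim
  have heq := Submodule.eq_of_le_of_finrank_eq hle (by
    rw [finrank_span_eq_card hX, Fintype.card_fin]; omega)
  have hvm : v ∈ Submodule.span ℝ (range X) := by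
    rw [heq, Submodule.mem_dualCoannihilator]
    intro φ hφ
    induction hφ using Submodule.span_induction with
    | mem φ hφ => obtain ⟨i, rfl⟩ := hφ; exact hv i
    | zero => rfl
    | add a b _ _ ha hb => simp [ha, hb]
    | smul c a _ ha => simp [ha]
  clear hv
  rw [← omegaL_apply]
  induction hvm using Submodule.span_induction with
  | mem x hx => obtain ⟨i, rfl⟩ := hx; rw [omegaL_apply, omega_hamVF]; exact hw i
  | zero => simp
  | add a b _ _ ha hb => simp [ha, hb]
  | smul c a _ ha => simp [ha]

end Form

/-! ### Symplectic vector fields and the Poincaré lemma -/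

section InfinitesimalSymplectic

/-- The continuous linear functional `A ↦ ω(A u, w) + ω(u, A w)` on endomorphisms. -/
noncomputable def spDefect (u w : PhaseSpace n) : (PhaseSpace n →L[ℝ] PhaseSpace n) →L[ℝ] ℝ :=
  ((omegaL n).flip w).comp (ContinuousLinearMap.apply ℝ (PhaseSpace n) u) +
    (omegaL n u).comp (ContinuousLinearMap.apply ℝ (PhaseSpace n) w)

theorem spDefect_apply (u w : PhaseSpace n) (A : PhaseSpace n →L[ℝ] PhaseSpace n) :
    spDefect u w A = omega (A u) w + omega u (A w) := by
  simp [spDefect, omegaL_apply]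

/-- The linear map `A` belongs to the symplectic Lie algebra. -/
def IsInfSymplectic (A : PhaseSpace n →L[ℝ] PhaseSpace n) : Prop :=
  ∀ u w, spDefect u w A = 0

theorem IsInfSymplectic.omega_left {A : PhaseSpace n →L[ℝ] PhaseSpace n} (hA : IsInfSymplectic A)
    (u w : PhaseSpace n) : omega (A u) w = -omega u (A w) := by
  have := hA u w
  rw [spDefect_apply] at this
  linarith

theorem fderiv_omega_apply {E : Type*} [NormedAddCommGroup E] [NormedSpace ℝ E]
    {V V' : E → PhaseSpace n} {A A' : E →L[ℝ] PhaseSpace n} {y : E}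
    (hV : HasFDerivAt V A y) (hV' : HasFDerivAt V' A' y) (v : E) :
    fderiv ℝ (fun x => omega (V x) (V' x)) y v = omega (V y) (A' v) + omega (A v) (V' y) := by
  have h1 := (omegaL n).hasFDerivAt_of_bilinear hV hV'
  simp only [omegaL_apply] at h1
  rw [h1.fderiv]
  simp [omegaL_apply]

/-- Two symplectic vector fields which are everywhere `ω`-orthogonal commute. -/
theorem commute_of_omega_eq_zero {V V' : PhaseSpace n → PhaseSpace n} {y : PhaseSpace n}
    (hV : DifferentiableAt ℝ V y) (hV' : DifferentiableAt ℝ V' y)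
    (hs : IsInfSymplectic (fderiv ℝ V y)) (hs' : IsInfSymplectic (fderiv ℝ V' y))
    (h0 : ∀ᶠ x in 𝓝 y, omega (V x) (V' x) = 0) :
    fderiv ℝ V y (V' y) = fderiv ℝ V' y (V y) := by
  -- Differentiating `ω(V, V') = 0` along `v` and moving both derivatives across `ω` gives `ω([V,
  -- V'], v) = 0`, up to sign.
  refine eq_of_omega_left fun v => ?_
  have h1 := fderiv_omega_apply hV.hasFDerivAt hV'.hasFDerivAt v
  have h2 : (fun x => omega (V x) (V' x)) =ᶠ[𝓝 y] fun _ => 0 := h0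
  rw [h2.fderiv_eq] at h1
  have h3 := hs.omega_left (V' y) v
  have h4 := hs'.omega_left (V y) v
  rw [omega_swap (V' y)] at h3
  simp at h1
  linarith

/-- **Poincaré lemma** for symplectic vector fields on a ball. -/
theorem exists_hamVF_eq {X : PhaseSpace n → PhaseSpace n} (hX : ContDiff ℝ ∞ X) {ρ : ℝ}
    (hs : ∀ y ∈ Metric.ball (0 : PhaseSpace n) ρ, IsInfSymplectic (fderiv ℝ X y)) :
    ∃ H : PhaseSpace n → ℝ, ContDiff ℝ ∞ H ∧
      ∀ y ∈ Metric.ball (0 : PhaseSpace n) ρ, hamVF H y = X y := by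
  have hF : ContDiff ℝ ∞ (fun p : PhaseSpace n × ℝ => omega (X (p.2 • p.1)) p.1) := by
    simp only [← omegaL_apply]
    exact ((omegaL n).contDiff.comp (hX.comp (contDiff_snd.smul contDiff_fst))).clm_apply
      contDiff_fst
  refine ⟨fun y => ∫ s in (0 : ℝ)..1, omega (X (s • y)) y,
    contDiff_intervalIntegral (F := fun y s => omega (X (s • y)) y) hF 0 1, fun y hy =>
    hamVF_eq_iff.2 fun v => ?_⟩
  have hd := hasFDerivAt_intervalIntegral_of_contDiff (F := fun y s => omega (X (s • y)) y)
    (hF.of_le (by simp)) 0 1 y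
  have hXd : Differentiable ℝ X := hX.differentiable (by simp)
  have hc : Continuous fun s : ℝ => fderiv ℝ (fun x => omega (X (s • x)) x) y :=
    Continuous.fderiv_one (f := fun (s : ℝ) x => omega (X (s • x)) x)
      ((hF.comp (contDiff_snd.prodMk contDiff_fst)).of_le (by simp)) continuous_const
  rw [hd.fderiv, ContinuousLinearMap.intervalIntegral_apply (hc.intervalIntegrable _ _)]
  -- Infinitesimal symplecticity makes the derivative of the integrand in `y` a total derivative in
  -- `s`.
  have hder : ∀ s ∈ uIcc (0 : ℝ) 1, HasDerivAt (fun s => s * omega (X (s • y)) v)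
      (fderiv ℝ (fun x => omega (X (s • x)) x) y v) s := by
    intro s hs'
    rw [uIcc_of_le zero_le_one] at hs'
    have hsy : s • y ∈ Metric.ball (0 : PhaseSpace n) ρ := by
      rw [mem_ball_zero_iff] at hy ⊢
      rw [norm_smul, Real.norm_eq_abs, abs_of_nonneg hs'.1]
      exact (mul_le_of_le_one_left (norm_nonneg _) hs'.2).trans_lt hy
    have h1 : HasFDerivAt (fun x => X (s • x))
        ((fderiv ℝ X (s • y)).comp (s • ContinuousLinearMap.id ℝ (PhaseSpace n))) y :=
      HasFDerivAt.comp y (hXd (s • y)).hasFDerivAt ((hasFDerivAt_id y).const_smul s)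
    have h6 := fderiv_omega_apply h1 (hasFDerivAt_id y) v
    simp only [id] at h6
    rw [h6]
    have h2 : HasDerivAt (fun s : ℝ => X (s • y)) (fderiv ℝ X (s • y) y) s := by
      have := (hXd (s • y)).hasFDerivAt.comp_hasDerivAt s ((hasDerivAt_id s).smul_const y)
      simpa [Function.comp_def] using this
    have h3 : HasDerivAt (fun s : ℝ => omega (X (s • y)) v)
        (omega (fderiv ℝ X (s • y) y) v) s := by
      simp only [← omegaL_apply]
      exact ((omegaL n).flip v).hasFDerivAt.comp_hasDerivAt s h2
    refine ((hasDerivAt_id s).mul h3).congr_deriv ?_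
    have h4 := (hs _ hsy).omega_left v y
    rw [omega_swap v] at h4
    have h5 : omega (((fderiv ℝ X (s • y)).comp (s • ContinuousLinearMap.id ℝ (PhaseSpace n))) v) y
        = s * omega (fderiv ℝ X (s • y) v) y := by
      simp [← omegaL_apply]
    rw [h5, h4]
    simp
  rw [intervalIntegral.integral_eq_sub_of_hasDerivAt hder
    ((hc.clm_apply continuous_const).intervalIntegrable _ _)]
  simp

end InfinitesimalSymplectic

/-! ### Homogeneous functions -/

section Homogeneous

variable {f : PhaseSpace n → ℝ} {k : ℕ}

/-- **Euler's identity** for homogeneous functions. -/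
theorem fderiv_self_of_homogeneous (hf : Differentiable ℝ f)
    (hk : ∀ (t : ℝ) x, f (t • x) = t ^ k * f x) (x : PhaseSpace n) :
    fderiv ℝ f x x = k * f x := by
  have h1 : HasDerivAt (fun t : ℝ => f (t • x)) (fderiv ℝ f ((1 : ℝ) • x) x) 1 := by
    have := (hf ((1 : ℝ) • x)).hasFDerivAt.comp_hasDerivAt (1 : ℝ)
      ((hasDerivAt_id (1 : ℝ)).smul_const x)
    simpa [Function.comp_def] using this
  simp only [hk, one_smul] at h1
  have h2 := ((hasDerivAt_pow k (1 : ℝ)).mul_const (f x))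
  simpa using h1.unique h2

/-- Differentiating the homogeneity relation gives `t df(t x) = t ^ k df(x)`. Tangency thus passes
from `Y` to its rescalings. -/
theorem fderiv_eq_zero_of_homogeneous (hf : Differentiable ℝ f)
    (hk : ∀ (t : ℝ) x, f (t • x) = t ^ k * f x) {t : ℝ} (ht : t ≠ 0) {x v : PhaseSpace n}
    (h0 : fderiv ℝ f (t • x) v = 0) : fderiv ℝ f x v = 0 := by
  have h1 : HasFDerivAt (fun x => f (t • x))
      ((fderiv ℝ f (t • x)).comp (t • ContinuousLinearMap.id ℝ (PhaseSpace n))) x :=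
    HasFDerivAt.comp x (hf (t • x)).hasFDerivAt ((hasFDerivAt_id x).const_smul t)
  simp only [hk] at h1
  have h2 := (hf x).hasFDerivAt.const_mul (t ^ k)
  have h3 := DFunLike.congr_fun (h1.unique h2) v
  simpa [h0, ht] using h3.symm

end Homogeneous

end SymplecticGerm

/-! ### Rescaling at the origin -/

section Rescaling

variable {E G : Type} [NormedAddCommGroup E] [NormedSpace ℝ E] [FiniteDimensional ℝ E]
  [NormedAddCommGroup G] [NormedSpace ℝ G]

/-- The rescaled family `f (t x) / t` extends smoothly to `t = 0` by the derivative of `f`. -/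
theorem exists_rescale_eq_smul [CompleteSpace G] {f : E → G} (hf : ContDiff ℝ ∞ f)
    (h0 : f 0 = 0) :
    ∃ R : ℝ → E → G, ContDiff ℝ ∞ (fun p : ℝ × E => R p.1 p.2) ∧
      (∀ t x, f (t • x) = t • R t x) ∧ ∀ x, R 0 x = fderiv ℝ f 0 x := by
  obtain ⟨R, hR, hfR⟩ := exists_contDiff_eq_smul (F := fun t x => f (t • x))
    (hf.comp (contDiff_fst.smul contDiff_snd)) (fun x => by simp [h0])
  refine ⟨R, hR, hfR, fun x => ?_⟩
  have h1 : HasDerivAt (fun t : ℝ => f (t • x)) (fderiv ℝ f 0 x) 0 := by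
    have := (hf.differentiable (by simp) ((0 : ℝ) • x)).hasFDerivAt.comp_hasDerivAt (0 : ℝ)
      ((hasDerivAt_id (0 : ℝ)).smul_const x)
    simpa [Function.comp_def] using this
  have h2 : Differentiable ℝ fun t => R t x :=
    (hR.comp (contDiff_id.prodMk contDiff_const)).differentiable (by simp)
  have h3 := (hasDerivAt_id (0 : ℝ)).smul (h2 0).hasDerivAt
  have h4 : (fun t : ℝ => f (t • x)) = fun t => t • R t x := funext fun t => hfR t x
  rw [h4] at h1
  simpa using h3.unique h1

/-- If `f` vanishes to second order, then `f (t x) / t ^ 2` extends smoothly to `t = 0`. -/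
theorem exists_rescale_eq_smul_smul [CompleteSpace G] {f : E → G} (hf : ContDiff ℝ ∞ f)
    (h0 : f 0 = 0) (h1 : fderiv ℝ f 0 = 0) :
    ∃ R : ℝ → E → G, ContDiff ℝ ∞ (fun p : ℝ × E => R p.1 p.2) ∧
      ∀ t x, f (t • x) = t • t • R t x := by
  obtain ⟨R, hR, hfR, hR0⟩ := exists_rescale_eq_smul hf h0
  obtain ⟨S, hS, hRS⟩ := exists_contDiff_eq_smul hR (fun x => by simp [hR0, h1])
  exact ⟨S, hS, fun t x => by rw [hfR, hRS]⟩

/-- Identities for rescaled families come from division by `t`; continuity recovers `t = 0`. -/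
theorem eq_zero_on_Icc_of_continuous {F : Type*} [TopologicalSpace F] [T2Space F] {φ ψ : ℝ → F}
    (hφ : Continuous φ) (hψ : Continuous ψ) (h : ∀ t ∈ Ioc (0 : ℝ) 1, φ t = ψ t) :
    ∀ t ∈ Icc (0 : ℝ) 1, φ t = ψ t := by
  intro t ht
  rw [← closure_Ioc zero_ne_one] at ht
  exact (isClosed_eq hφ hψ).closure_subset_iff.2 h ht

theorem eventually_forall_Icc_mem {X F : Type*} [TopologicalSpace X] [TopologicalSpace F]
    {φ : X × ℝ → F} (hφ : Continuous φ) {x₀ : X} {s : Set F}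
    (h : ∀ t ∈ Icc (0 : ℝ) 1, s ∈ 𝓝 (φ (x₀, t))) :
    ∀ᶠ x in 𝓝 x₀, ∀ t ∈ Icc (0 : ℝ) 1, φ (x, t) ∈ s :=
  isCompact_Icc.eventually_forall_of_forall_eventually fun t ht =>
    hφ.continuousAt.eventually (h t ht)

end Rescaling

/-! ### The isotopy to the identity and its generating field -/

namespace SymplecticGerm

variable {n : ℕ}

/-- The field `χ_* E - E`, where `E` is the Euler field and `χ` is a symplectic germ tangent to the
identity which preserves homogeneous functions `h_i`. -/
theorem exists_radial_defect {h : Fin n → PhaseSpace n → ℝ}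
    (h_smooth : ∀ i, ContDiff ℝ ∞ (h i))
    (h_homog : ∀ i, ∃ k : ℕ, ∀ (t : ℝ) (x : PhaseSpace n), h i (t • x) = t ^ k * h i x)
    {χ θ : PhaseSpace n → PhaseSpace n} (hχ : ContDiff ℝ ∞ χ) (hθ : ContDiff ℝ ∞ θ)
    (hχ0 : χ 0 = 0) (hχ' : fderiv ℝ χ 0 = ContinuousLinearMap.id ℝ _)
    (hl : ∀ᶠ x in 𝓝 0, θ (χ x) = x) (hr : ∀ᶠ y in 𝓝 0, χ (θ y) = y)
    (hω : ∀ᶠ x in 𝓝 0, PreservesOmega (fderiv ℝ χ x))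
    (hh : ∀ᶠ x in 𝓝 0, ∀ i, h i (χ x) = h i x) :
    ∃ Y : PhaseSpace n → PhaseSpace n, ContDiff ℝ ∞ Y ∧ Y 0 = 0 ∧ fderiv ℝ Y 0 = 0 ∧
      (∀ᶠ x in 𝓝 0, Y (χ x) = fderiv ℝ χ x x - χ x) ∧
      (∀ᶠ y in 𝓝 0, IsInfSymplectic (fderiv ℝ Y y)) ∧
      ∀ᶠ y in 𝓝 0, ∀ i, fderiv ℝ (h i) y (Y y) = 0 := by
  have hDχ : ContDiff ℝ ∞ (fderiv ℝ χ) := hχ.fderiv_right (by simp)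
  have hθ0 : θ 0 = 0 := by simpa [hχ0] using hl.self_of_nhds
  have hθt : Tendsto θ (𝓝 0) (𝓝 0) := by
    simpa [hθ0] using hθ.continuous.tendsto 0
  have hχd : Differentiable ℝ χ := hχ.differentiable (by simp)
  have hDχd : Differentiable ℝ (fderiv ℝ χ) := hDχ.differentiable (by simp)
  set Y : PhaseSpace n → PhaseSpace n := fun y => fderiv ℝ χ (θ y) (θ y) - y
  have hY : ContDiff ℝ ∞ Y := ((hDχ.comp hθ).clm_apply hθ).sub contDiff_id
  have hYχ : ∀ᶠ x in 𝓝 0, Y (χ x) = fderiv ℝ χ x x - χ x := by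
    filter_upwards [hl] with x hx
    simp only [Y, hx]
  -- The two terms `Dχ(x) v` cancel, leaving the second derivative.
  have hDY : ∀ᶠ x in 𝓝 0, ∀ v,
      fderiv ℝ Y (χ x) (fderiv ℝ χ x v) = fderiv ℝ (fderiv ℝ χ) x v x := by
    filter_upwards [hYχ.eventually_nhds] with x hx v
    have h1 : HasFDerivAt (Y ∘ χ) ((fderiv ℝ Y (χ x)).comp (fderiv ℝ χ x)) x :=
      ((hY.differentiable (by simp)) (χ x)).hasFDerivAt.comp x (hχd x).hasFDerivAt
    have h2 := ((hDχd x).hasFDerivAt.clm_apply (hasFDerivAt_id x)).sub (hχd x).hasFDerivAt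
    have h3 := h2.congr_of_eventuallyEq (f₁ := Y ∘ χ) hx
    simpa using DFunLike.congr_fun (h1.unique h3) v
  have hY0 : Y 0 = 0 := by simp [Y, hθ0]
  refine ⟨Y, hY, hY0, ?_, hYχ, ?_, ?_⟩
  · ext1 v
    simpa [hχ0, hχ'] using hDY.self_of_nhds v
  · filter_upwards [hr, hθt.eventually hDY, hθt.eventually hω.eventually_nhds] with y hy hDYy hωy
    set x := θ y
    have hA : PreservesOmega (fderiv ℝ χ x) := hωy.self_of_nhds
    -- By symmetry the defect of `DY` is the derivative along `x` of `ω(Dχ u, Dχ w)`, which is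
    -- locally constant.
    have hsymm : ∀ u v, fderiv ℝ (fderiv ℝ χ) x u v = fderiv ℝ (fderiv ℝ χ) x v u :=
      ((contDiff_infty.1 hχ 2).contDiffAt (x := x)).isSymmSndFDerivAt (by simp)
    intro u w
    obtain ⟨u, rfl⟩ := hA.surjective u
    obtain ⟨w, rfl⟩ := hA.surjective w
    rw [spDefect_apply, ← hy, hDYy, hDYy, hsymm u x, hsymm w x]
    have h1 := fderiv_omega_apply ((hDχd x).hasFDerivAt.clm_apply (hasFDerivAt_const u x))
      ((hDχd x).hasFDerivAt.clm_apply (hasFDerivAt_const w x)) x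
    have h2 : (fun x => omega (fderiv ℝ χ x u) (fderiv ℝ χ x w)) =ᶠ[𝓝 x] fun _ => omega u w :=
      hωy.mono fun x hx => hx u w
    rw [h2.fderiv_eq] at h1
    simp at h1
    linarith
  · have hh' : ∀ᶠ x in 𝓝 0, ∀ i, ∀ᶠ x' in 𝓝 x, h i (χ x') = h i x' :=
      hh.eventually_nhds.mono fun x hx i => hx.mono fun x' hx' => hx' i
    filter_upwards [hr, hθt.eventually hYχ, hθt.eventually hh'] with y hy hYy hhy i
    obtain ⟨k, hk⟩ := h_homog i
    have hd : Differentiable ℝ (h i) := (h_smooth i).differentiable (by simp)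
    set x := θ y
    have h1 : fderiv ℝ (h i) (χ x) (fderiv ℝ χ x x) = fderiv ℝ (h i) x x := by
      have h2 : HasFDerivAt (h i ∘ χ) ((fderiv ℝ (h i) (χ x)).comp (fderiv ℝ χ x)) x :=
        (hd (χ x)).hasFDerivAt.comp x (hχd x).hasFDerivAt
      have h3 := (hd x).hasFDerivAt.congr_of_eventuallyEq (f₁ := h i ∘ χ) (hhy i)
      exact DFunLike.congr_fun (h2.unique h3) x
    rw [← hy, hYy, map_sub, h1, fderiv_self_of_homogeneous hd hk, fderiv_self_of_homogeneous hd hk,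
      (hhy i).self_of_nhds, sub_self]

/-- The primitive in time of a family of vector fields which are symplectic and tangent to a
foliation has the same two properties. -/
theorem primitive_properties {G : ℝ → PhaseSpace n → PhaseSpace n}
    (hG : ContDiff ℝ ∞ (fun p : ℝ × PhaseSpace n => G p.1 p.2)) {y : PhaseSpace n} {t : ℝ}
    (ht : t ∈ Icc (0 : ℝ) 1) :
    ((∀ τ ∈ Icc (0 : ℝ) 1, IsInfSymplectic (fderiv ℝ (G τ) y)) →
      IsInfSymplectic (fderiv ℝ (fun y => ∫ τ in (0 : ℝ)..t, G τ y) y)) ∧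
    ∀ φ : PhaseSpace n →L[ℝ] ℝ, (∀ τ ∈ Icc (0 : ℝ) 1, φ (G τ y) = 0) →
      φ (∫ τ in (0 : ℝ)..t, G τ y) = 0 := by
  have hG' : ContDiff ℝ ∞ (fun p : PhaseSpace n × ℝ => G p.2 p.1) :=
    hG.comp (contDiff_snd.prodMk contDiff_fst)
  have hsub : ∀ τ ∈ uIcc 0 t, τ ∈ Icc (0 : ℝ) 1 := by
    intro τ hτ
    rw [uIcc_of_le ht.1] at hτ
    exact ⟨hτ.1, hτ.2.trans ht.2⟩
  have hc : Continuous fun τ => fderiv ℝ (G τ) y :=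
    Continuous.fderiv_one (hG.of_le (by simp)) continuous_const
  have hc' : Continuous fun τ => G τ y := hG.continuous.comp (Continuous.prodMk_left y)
  refine ⟨fun hs u w => ?_, fun φ hφ => ?_⟩
  -- Being infinitesimally symplectic means that the continuous functionals `spDefect u w` vanish,
  -- and these commute with the integral.
  · rw [(hasFDerivAt_intervalIntegral_of_contDiff (F := fun y τ => G τ y)
      (hG'.of_le (by simp)) 0 t y).fderiv,
      ← ContinuousLinearMap.intervalIntegral_comp_comm _ (hc.intervalIntegrable _ _)]
    rw [intervalIntegral.integral_congr (g := fun _ => (0 : ℝ)) fun τ hτ => hs τ (hsub τ hτ) u w]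
    simp
  · rw [← ContinuousLinearMap.intervalIntegral_comp_comm _ (hc'.intervalIntegrable _ _)]
    rw [intervalIntegral.integral_congr (g := fun _ => (0 : ℝ)) fun τ hτ => hφ τ (hsub τ hτ)]
    simp

/-- The rescaled family `Y (t y) / t ^ 2` of a symplectic vector field `Y` tangent to the fibration
of homogeneous functions. -/
theorem exists_rescaled_field {h : Fin n → PhaseSpace n → ℝ}
    (h_smooth : ∀ i, ContDiff ℝ ∞ (h i))
    (h_homog : ∀ i, ∃ k : ℕ, ∀ (t : ℝ) (x : PhaseSpace n), h i (t • x) = t ^ k * h i x)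
    {Y : PhaseSpace n → PhaseSpace n} (hY : ContDiff ℝ ∞ Y) (hY0 : Y 0 = 0)
    (hY' : fderiv ℝ Y 0 = 0) {ρ : ℝ}
    (hball : ∀ y ∈ Metric.ball 0 ρ,
      IsInfSymplectic (fderiv ℝ Y y) ∧ ∀ i, fderiv ℝ (h i) y (Y y) = 0) :
    ∃ G : ℝ → PhaseSpace n → PhaseSpace n,
      ContDiff ℝ ∞ (fun p : ℝ × PhaseSpace n => G p.1 p.2) ∧
      (∀ t x, Y (t • x) = t • t • G t x) ∧
      (∀ y ∈ Metric.ball 0 ρ, ∀ t ∈ Icc (0 : ℝ) 1, IsInfSymplectic (fderiv ℝ (G t) y)) ∧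
      (∀ y ∈ Metric.ball 0 ρ, ∀ i, ∀ t ∈ Icc (0 : ℝ) 1, fderiv ℝ (h i) y (G t y) = 0) ∧
      (∀ t ∈ Icc (0 : ℝ) 1, G t 0 = 0) ∧ ∀ t ∈ Icc (0 : ℝ) 1, fderiv ℝ (G t) 0 = 0 := by
  obtain ⟨G, hG, hYG⟩ := exists_rescale_eq_smul_smul hY hY0 hY'
  set B : Set (PhaseSpace n) := Metric.ball 0 ρ
  have hBt : ∀ y ∈ B, ∀ t ∈ Ioc (0 : ℝ) 1, t • y ∈ B := by
    intro y hy t ht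
    rw [mem_ball_zero_iff] at hy ⊢
    rw [norm_smul, Real.norm_eq_abs, abs_of_pos ht.1]
    exact (mul_le_of_le_one_left (norm_nonneg _) ht.2).trans_lt hy
  have hGt : ∀ t, ContDiff ℝ ∞ (G t) := fun t => hG.comp (contDiff_const.prodMk contDiff_id)
  have hGd : ∀ t, Differentiable ℝ (G t) := fun t => (hGt t).differentiable (by simp)
  have hGc : ∀ y, Continuous fun t => G t y := fun y =>
    hG.continuous.comp (Continuous.prodMk_left y)
  have hG'c : ∀ y, Continuous fun t => fderiv ℝ (G t) y := fun y =>
    Continuous.fderiv_one (hG.of_le (by simp)) continuous_const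
  have hDG : ∀ t, t ≠ 0 → ∀ y, fderiv ℝ (G t) y = t⁻¹ • fderiv ℝ Y (t • y) := by
    intro t ht y
    have h1 : HasFDerivAt (fun y => Y (t • y))
        ((fderiv ℝ Y (t • y)).comp (t • ContinuousLinearMap.id ℝ (PhaseSpace n))) y :=
      HasFDerivAt.comp y (hY.differentiable (by simp) (t • y)).hasFDerivAt
        ((hasFDerivAt_id y).const_smul t)
    simp only [hYG] at h1
    have h2 := (((hGd t y).hasFDerivAt.const_smul t).const_smul t).unique h1
    ext1 v
    have h3 := DFunLike.congr_fun h2 v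
    simp only [smul_apply, ContinuousLinearMap.comp_apply,
      ContinuousLinearMap.id_apply, map_smul] at h3 ⊢
    rw [← smul_right_injective _ ht h3, inv_smul_smul₀ ht]
  have hGs : ∀ y ∈ B, ∀ t ∈ Icc (0 : ℝ) 1, IsInfSymplectic (fderiv ℝ (G t) y) := by
    intro y hy t ht u w
    refine eq_zero_on_Icc_of_continuous ((spDefect u w).continuous.comp (hG'c y))
      continuous_const (fun t ht => ?_) t ht
    simp only [Function.comp_apply]
    rw [hDG t ht.1.ne', map_smul, (hball _ (hBt y hy t ht)).1 u w, smul_zero]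
  have hGh : ∀ y ∈ B, ∀ i, ∀ t ∈ Icc (0 : ℝ) 1, fderiv ℝ (h i) y (G t y) = 0 := by
    intro y hy i t ht
    refine eq_zero_on_Icc_of_continuous ((fderiv ℝ (h i) y).continuous.comp (hGc y))
      continuous_const (fun t ht => ?_) t ht
    obtain ⟨k, hk⟩ := h_homog i
    refine fderiv_eq_zero_of_homogeneous ((h_smooth i).differentiable (by simp)) hk ht.1.ne' ?_
    have h1 := (hball _ (hBt y hy t ht)).2 i
    rw [hYG, map_smul, map_smul] at h1
    simpa [ht.1.ne'] using h1
  have hG0 : ∀ t ∈ Icc (0 : ℝ) 1, G t 0 = 0 := by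
    refine eq_zero_on_Icc_of_continuous (hGc 0) continuous_const fun t ht => ?_
    have h1 := hYG t 0
    rw [smul_zero, hY0] at h1
    simpa [ht.1.ne'] using h1.symm
  have hG'0 : ∀ t ∈ Icc (0 : ℝ) 1, fderiv ℝ (G t) 0 = 0 := by
    refine eq_zero_on_Icc_of_continuous (hG'c 0) continuous_const fun t ht => ?_
    rw [hDG t ht.1.ne', smul_zero, hY', smul_zero]
  exact ⟨G, hG, hYG, hGs, hGh, hG0, hG'0⟩

/-- The curves `χ (t x) / t` solve the equation of the rescaled family of `Y = χ_* E - E`. -/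
theorem exists_isotopy {χ Y : PhaseSpace n → PhaseSpace n} {G : ℝ → PhaseSpace n → PhaseSpace n}
    (hχ : ContDiff ℝ ∞ χ) (hχ0 : χ 0 = 0) (hχ' : fderiv ℝ χ 0 = ContinuousLinearMap.id ℝ _)
    (hYχ : ∀ᶠ x in 𝓝 0, Y (χ x) = fderiv ℝ χ x x - χ x)
    (hG : ContDiff ℝ ∞ (fun p : ℝ × PhaseSpace n => G p.1 p.2))
    (hYG : ∀ t x, Y (t • x) = t • t • G t x) {s : Set (PhaseSpace n)} (hs : s ∈ 𝓝 0) :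
    ∀ᶠ x in 𝓝 (0 : PhaseSpace n), ∃ r : ℝ → PhaseSpace n, r 0 = x ∧ r 1 = χ x ∧
      (∀ t ∈ Icc (0 : ℝ) 1, r t ∈ s) ∧ Continuous r ∧
      ∀ t ∈ Icc (0 : ℝ) 1, HasDerivAt r (G t (r t)) t := by
  obtain ⟨R, hR, hχR, hR0⟩ := exists_rescale_eq_smul hχ hχ0
  simp only [hχ', ContinuousLinearMap.id_apply] at hR0
  have hRz : ∀ t ∈ Icc (0 : ℝ) 1, R t 0 = 0 := by
    refine eq_zero_on_Icc_of_continuous (hR.continuous.comp (Continuous.prodMk_left 0))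
      continuous_const fun t ht => ?_
    have h1 := hχR t 0
    rw [smul_zero, hχ0] at h1
    simpa [ht.1.ne'] using h1.symm
  have hRs : ∀ᶠ x in 𝓝 (0 : PhaseSpace n), ∀ t ∈ Icc (0 : ℝ) 1, R t x ∈ s :=
    eventually_forall_Icc_mem (φ := fun p : PhaseSpace n × ℝ => R p.2 p.1)
      (hR.continuous.comp continuous_swap) fun t ht => by rwa [hRz t ht]
  obtain ⟨ε, hε, hεball⟩ := Metric.eventually_nhds_iff_ball.1 hYχ
  filter_upwards [hRs, Metric.ball_mem_nhds _ hε] with x hxR hxε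
  have hRx : ContDiff ℝ ∞ fun t => R t x := hR.comp (contDiff_id.prodMk contDiff_const)
  have hRxd : ∀ t, HasDerivAt (fun t => R t x) (deriv (fun t => R t x) t) t := fun t =>
    (hRx.differentiable (by simp) t).hasDerivAt
  -- For `t > 0`, differentiating `χ(t x) = t R` gives `Dχ(t x) x = R + t R'`, so `Y (t R) = t ^ 2
  -- R'`.
  have hRG : ∀ t ∈ Icc (0 : ℝ) 1, deriv (fun t => R t x) t = G t (R t x) := by
    refine eq_zero_on_Icc_of_continuous (hRx.continuous_deriv (by simp))
      (hG.continuous.comp (continuous_id.prodMk hRx.continuous)) fun t ht => ?_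
    have h1 : HasDerivAt (fun t : ℝ => χ (t • x)) (fderiv ℝ χ (t • x) x) t := by
      have := (hχ.differentiable (by simp) (t • x)).hasFDerivAt.comp_hasDerivAt t
        ((hasDerivAt_id t).smul_const x)
      simpa [Function.comp_def] using this
    simp only [hχR] at h1
    have h2 := ((hasDerivAt_id t).smul (hRxd t)).unique h1
    have h3 : t • x ∈ Metric.ball (0 : PhaseSpace n) ε := by
      rw [mem_ball_zero_iff] at hxε ⊢
      rw [norm_smul, Real.norm_eq_abs, abs_of_pos ht.1]
      exact (mul_le_of_le_one_left (norm_nonneg _) ht.2).trans_lt hxε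
    have h4 := hεball _ h3
    rw [hχR, hYG, map_smul, ← h2] at h4
    have h5 := smul_right_injective _ ht.1.ne'
      (h4.trans (smul_sub _ _ _).symm : t • (t • G t (R t x)) = t • _)
    simp only [id, one_smul, add_sub_cancel_right] at h5
    exact (smul_right_injective _ ht.1.ne' h5).symm
  refine ⟨fun t => R t x, hR0 x, ?_, hxR, hRx.continuous, fun t ht => hRG t ht ▸ hRxd t⟩
  have := hχR 1 x
  simpa using this.symm

/-- A symplectic germ tangent to the identity which preserves a homogeneous integrable system is
the time-1 map of a Hamiltonian vector field tangent to its fibration. -/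
theorem exists_isTimeOneMap {h : Fin n → PhaseSpace n → ℝ}
    (h_smooth : ∀ i, ContDiff ℝ ∞ (h i))
    (h_comm : ∀ i j x, poissonBracket (h i) (h j) x = 0)
    (h_homog : ∀ i, ∃ k : ℕ, ∀ (t : ℝ) (x : PhaseSpace n), h i (t • x) = t ^ k * h i x)
    (h_indep : Dense {x | LinearIndependent ℝ fun i => fderiv ℝ (h i) x})
    {χ θ : PhaseSpace n → PhaseSpace n} (hχ : ContDiff ℝ ∞ χ) (hθ : ContDiff ℝ ∞ θ)
    (hχ0 : χ 0 = 0) (hχ' : fderiv ℝ χ 0 = ContinuousLinearMap.id ℝ _)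
    (hl : ∀ᶠ x in 𝓝 0, θ (χ x) = x) (hr : ∀ᶠ y in 𝓝 0, χ (θ y) = y)
    (hω : ∀ᶠ x in 𝓝 0, PreservesOmega (fderiv ℝ χ x))
    (hh : ∀ᶠ x in 𝓝 0, ∀ i, h i (χ x) = h i x) :
    ∃ X : PhaseSpace n → PhaseSpace n, MemLieAlg h X ∧ IsTimeOneMap X χ := by
  obtain ⟨Y, hY, hY0, hY', hYχ, hYs, hYh⟩ := exists_radial_defect h_smooth h_homog hχ hθ hχ0 hχ'
    hl hr hω hh
  obtain ⟨ρ, hρ, hball⟩ := Metric.eventually_nhds_iff_ball.1 (hYs.and hYh)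
  set B : Set (PhaseSpace n) := Metric.ball 0 ρ
  obtain ⟨G, hG, hYG, hGs, hGh, hG0, hG'0⟩ :=
    exists_rescaled_field h_smooth h_homog hY hY0 hY' hball
  have hGt : ∀ t, ContDiff ℝ ∞ (G t) := fun t => hG.comp (contDiff_const.prodMk contDiff_id)
  have hGc : ∀ y, Continuous fun t => G t y := fun y =>
    hG.continuous.comp (Continuous.prodMk_left y)
  set Z : ℝ → PhaseSpace n → PhaseSpace n := fun t y => ∫ τ in (0 : ℝ)..t, G τ y
  have hZ : ContDiff ℝ ∞ (fun p : ℝ × PhaseSpace n => Z p.1 p.2) := contDiff_primitive hG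
  have hZt : ∀ t, ContDiff ℝ ∞ (Z t) := fun t => hZ.comp (contDiff_const.prodMk contDiff_id)
  have hZs : ∀ y ∈ B, ∀ t ∈ Icc (0 : ℝ) 1, IsInfSymplectic (fderiv ℝ (Z t) y) :=
    fun y hy t ht => (primitive_properties hG ht).1 (hGs y hy)
  have hZh : ∀ y ∈ B, ∀ i, ∀ t ∈ Icc (0 : ℝ) 1, fderiv ℝ (h i) y (Z t y) = 0 :=
    fun y hy i t ht => (primitive_properties hG ht).2 _ (hGh y hy i)
  have horth : ∀ t ∈ Icc (0 : ℝ) 1, ∀ y ∈ B, omega (Z t y) (G t y) = 0 := by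
    intro t ht y hy
    have hcont : Continuous fun y => omega (Z t y) (G t y) := by
      simp only [← omegaL_apply]
      exact ((omegaL n).continuous.comp (hZt t).continuous).clm_apply (hGt t).continuous
    -- A nonzero value would persist on an open set, which meets the dense set of independence.
    by_contra hne
    obtain ⟨z, hzi, hz, hzB⟩ := h_indep.exists_mem_open
      ((isOpen_ne_fun hcont continuous_const).inter Metric.isOpen_ball) ⟨y, hne, hy⟩
    exact hz (omega_eq_zero_of_tangent (fun i j => h_comm i j z) hzi
      (fun i => hZh z hzB i t ht) fun i => hGh z hzB i t ht)
  have hcomm : ∀ t ∈ Icc (0 : ℝ) 1, ∀ y ∈ B,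
      fderiv ℝ (Z t) y (G t y) = fderiv ℝ (G t) y (Z t y) := fun t ht y hy =>
    commute_of_omega_eq_zero ((hZt t).differentiable (by simp) y) ((hGt t).differentiable (by simp) y) (hZs y hy t ht)
      (hGs y hy t ht) (by
        filter_upwards [Metric.isOpen_ball.mem_nhds hy] with x hx using horth t ht x hx)
  have hone : (1 : ℝ) ∈ Icc (0 : ℝ) 1 := by simp
  obtain ⟨H, hH, hHZ⟩ := exists_hamVF_eq (hZt 1) (fun y hy => hZs y hy 1 hone)
  have hB0 : B ∈ 𝓝 0 := Metric.ball_mem_nhds _ hρ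
  refine ⟨Z 1, ⟨⟨H, ⟨univ, univ_mem, hH.contDiffOn⟩, ?_⟩, ?_, ?_⟩, fun U hU => ?_⟩
  · filter_upwards [hB0] with y hy using (hHZ y hy).symm
  · change ∫ τ in (0 : ℝ)..1, G τ 0 = 0
    rw [intervalIntegral.integral_congr (g := fun _ => 0) fun τ hτ => hG0 τ (by
      rwa [uIcc_of_le zero_le_one] at hτ)]
    simp
  · filter_upwards [hB0] with y hy i using hZh y hy i 1 hone
  -- `DG t` vanishes at the origin, so compactness of `[0, 1]` gives a bound uniform in `t`.
  have hsmall : ∀ᶠ y in 𝓝 (0 : PhaseSpace n), ∀ t ∈ Icc (0 : ℝ) 1,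
      ‖fderiv ℝ (G t) y‖ ≤ 1 / 2 := by
    have hc : Continuous fun p : PhaseSpace n × ℝ => fderiv ℝ (G p.2) p.1 :=
      Continuous.fderiv_one (f := fun (p : PhaseSpace n × ℝ) y => G p.2 y)
        ((hG.comp ((contDiff_snd.comp contDiff_fst).prodMk contDiff_snd)).of_le (by simp))
        continuous_fst
    have h1 := eventually_forall_Icc_mem (x₀ := (0 : PhaseSpace n)) hc
      (s := Metric.closedBall 0 (1 / 2)) fun t ht => by
        simp only [hG'0 t ht]
        exact Metric.closedBall_mem_nhds _ (by norm_num)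
    simpa only [mem_closedBall_zero_iff] using h1
  obtain ⟨b, hb, hbsub⟩ := Metric.nhds_basis_closedBall.mem_iff.1
    (inter_mem (inter_mem hU hB0) hsmall)
  set a := b / 2 with ha_def
  have ha : 0 < a := by positivity
  have h2a : 2 * a = b := by rw [ha_def]; ring
  have hab : Metric.closedBall (0 : PhaseSpace n) a ⊆ Metric.closedBall 0 b :=
    Metric.closedBall_subset_closedBall (by linarith)
  filter_upwards [exists_isotopy hχ hχ0 hχ' hYχ hG hYG (Metric.closedBall_mem_nhds _ ha),
    Metric.closedBall_mem_nhds _ (half_pos ha)] with x ⟨r, hr0, hr1, hra, hrc, hrG⟩ hxa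
  obtain ⟨γ, hγ0, hγ1, hγa, hγ⟩ := exists_isIntegralCurveOn_of_commute (R := r) hG hZ
    ha hG0 (fun t ht y hy => (hbsub (by rwa [h2a] at hy)).2 t ht) (fun y => by simp [Z])
    (fun t y => intervalIntegral.integral_hasDerivAt_right ((hGc y).intervalIntegrable _ _)
      (hGc y).stronglyMeasurable.stronglyMeasurableAtFilter (hGc y).continuousAt)
    (fun t ht y hy => hcomm t ht y (hbsub (hab hy)).1.2) (by rwa [hr0]) hrc.continuousOn
    (fun t ht => (hrG t ⟨ht.1, ht.2.le⟩).hasDerivWithinAt) hra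
  exact ⟨γ, by rw [hγ0, hr0], by rw [hγ1, hr1], fun t ht => (hbsub (hab (hγa t ht))).1.1, hγ⟩

end SymplecticGerm

/-! ### Normalized Hamiltonians and invariance under the linear part -/

namespace SymplecticGerm

variable {n : ℕ}

theorem IsTimeOneMap.congr {X φ φ' : PhaseSpace n → PhaseSpace n} (h : IsTimeOneMap X φ)
    (hφ : φ =ᶠ[𝓝 0] φ') : IsTimeOneMap X φ' := by
  intro U hU
  filter_upwards [h U hU, hφ] with x ⟨γ, h0, h1, h2, h3⟩ hx
  exact ⟨γ, h0, h1.trans hx, h2, h3⟩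

/-- A germ of Hamiltonian vector fields has a unique Hamiltonian which vanishes at the origin. -/
theorem exists_unique_normalizedHamiltonian {X : PhaseSpace n → PhaseSpace n}
    (hX : ∃ H : PhaseSpace n → ℝ, SmoothNearZero H ∧ X =ᶠ[𝓝 0] hamVF H) :
    ∃ Ψ : PhaseSpace n → ℝ, IsNormalizedHamiltonian X Ψ ∧
      ∀ Ψ' : PhaseSpace n → ℝ, IsNormalizedHamiltonian X Ψ' → Ψ' =ᶠ[𝓝 0] Ψ := by
  obtain ⟨H, ⟨U, hU, hHU⟩, hXH⟩ := hX
  have hN : IsNormalizedHamiltonian X fun x => H x - H 0 := by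
    refine ⟨⟨U, hU, hHU.sub contDiffOn_const⟩, by simp, ?_⟩
    filter_upwards [hXH] with x hx
    rw [hx]
    simp [hamVF, fderiv_sub_const]
  refine ⟨_, hN, fun Ψ' hΨ' => ?_⟩
  obtain ⟨⟨V, hV, hΨV⟩, h0, hXΨ⟩ := hΨ'
  obtain ⟨r, hr, hball⟩ := Metric.eventually_nhds_iff_ball.1
    ((hXH.and hXΨ).and (eventually_mem_nhds_iff.2 (inter_mem hU hV)))
  have hd : ∀ x ∈ Metric.ball (0 : PhaseSpace n) r,
      DifferentiableAt ℝ H x ∧ DifferentiableAt ℝ Ψ' x := fun x hx =>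
    ⟨(hHU.contDiffAt (mem_of_superset (hball x hx).2 inter_subset_left)).differentiableAt (by simp),
      (hΨV.contDiffAt (mem_of_superset (hball x hx).2 inter_subset_right)).differentiableAt
        (by simp)⟩
  filter_upwards [Metric.ball_mem_nhds _ hr] with x hx
  refine (convex_ball (0 : PhaseSpace n) r).eqOn_of_fderivWithin_eq (𝕜 := ℝ)
    (fun y hy => (hd y hy).2.differentiableWithinAt)
    (fun y hy => ((hd y hy).1.sub_const _).differentiableWithinAt)
    (Metric.isOpen_ball.uniqueDiffOn) (fun y hy => ?_) (Metric.mem_ball_self hr) (by simp [h0]) hx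
  rw [fderivWithin_of_isOpen Metric.isOpen_ball hy, fderivWithin_of_isOpen Metric.isOpen_ball hy,
    fderiv_sub_const]
  ext1 v
  rw [← omega_hamVF, ← omega_hamVF, ← (hball y hy).1.1, ← (hball y hy).1.2]

/-- A homogeneous function preserved by a germ is preserved by its linear part. -/
theorem apply_fderiv_eq_of_homogeneous {f : PhaseSpace n → ℝ} (hf : Continuous f) {k : ℕ}
    (hk : ∀ (t : ℝ) x, f (t • x) = t ^ k * f x) {ψ : PhaseSpace n → PhaseSpace n}
    (hψ : DifferentiableAt ℝ ψ 0) (hψ0 : ψ 0 = 0) (hfψ : ∀ᶠ x in 𝓝 0, f (ψ x) = f x)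
    (x : PhaseSpace n) : f (fderiv ℝ ψ 0 x) = f x := by
  have h1 : HasDerivAt (fun t : ℝ => ψ (t • x)) (fderiv ℝ ψ 0 x) 0 := by
    have h0 : HasFDerivAt ψ (fderiv ℝ ψ 0) ((0 : ℝ) • x) := by simpa using hψ.hasFDerivAt
    simpa [Function.comp_def] using
      h0.comp_hasDerivAt (0 : ℝ) ((hasDerivAt_id (0 : ℝ)).smul_const x)
  have h2 := (hf.tendsto _).comp (hasDerivAt_iff_tendsto_slope_zero.1 h1)
  have h3 : Tendsto (fun t : ℝ => t • x) (𝓝[≠] 0) (𝓝 0) := by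
    have : Continuous fun t : ℝ => t • x := by fun_prop
    simpa using (this.tendsto 0).mono_left nhdsWithin_le_nhds
  refine tendsto_nhds_unique h2 (tendsto_const_nhds.congr' ?_)
  filter_upwards [h3.eventually hfψ, self_mem_nhdsWithin] with t ht ht0
  simp only [Function.comp_apply, zero_add, zero_smul, hψ0, sub_zero]
  rw [hk, ht, hk, ← mul_assoc, ← mul_pow, inv_mul_cancel₀ ht0, one_pow, one_mul]

end SymplecticGerm

/-! ### Reduction to a germ tangent to the identity -/

theorem mainTheorem5 (n : ℕ) (h : Fin n → SymplecticGerm.PhaseSpace n → ℝ)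
    (h_smooth : ∀ i, ContDiff ℝ ∞ (h i))
    (h_comm : ∀ i j x, SymplecticGerm.poissonBracket (h i) (h j) x = 0)
    (h_homog : ∀ i, ∃ k : ℕ, ∀ (t : ℝ) (x : SymplecticGerm.PhaseSpace n),
      h i (t • x) = t ^ k * h i x)
    (ψ : OpenPartialHomeomorph (SymplecticGerm.PhaseSpace n) (SymplecticGerm.PhaseSpace n))
    (hψ : SymplecticGerm.IsLocalSymplectomorphism ψ)
    (hψ_pres : ∀ᶠ x in 𝓝 (0 : SymplecticGerm.PhaseSpace n), ∀ i, h i (ψ x) = h i x) :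
    (SymplecticGerm.IsSymplectomorphism (SymplecticGerm.linearPart ψ) ∧
      ∀ i x, h i (SymplecticGerm.linearPart ψ x) = h i x) ∧
    ((∀ᵐ x : SymplecticGerm.PhaseSpace n, LinearIndependent ℝ (fun i => fderiv ℝ (h i) x)) →
      ∃ X : SymplecticGerm.PhaseSpace n → SymplecticGerm.PhaseSpace n,
        SymplecticGerm.MemLieAlg h X ∧
        SymplecticGerm.IsTimeOneMap X (fun y => SymplecticGerm.linearPart ψ (ψ.symm y))) ∧
    (∀ X : SymplecticGerm.PhaseSpace n → SymplecticGerm.PhaseSpace n,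
      SymplecticGerm.MemLieAlg h X →
      SymplecticGerm.IsTimeOneMap X (fun y => SymplecticGerm.linearPart ψ (ψ.symm y)) →
      ∃ Ψ : SymplecticGerm.PhaseSpace n → ℝ, SymplecticGerm.IsNormalizedHamiltonian X Ψ ∧
        ∀ Ψ' : SymplecticGerm.PhaseSpace n → ℝ, SymplecticGerm.IsNormalizedHamiltonian X Ψ' →
          Ψ' =ᶠ[𝓝 0] Ψ) := by
  have hA : SymplecticGerm.PreservesOmega (SymplecticGerm.linearPart ψ) :=
    hψ.preserves 0 hψ.zero_mem
  have hdψ : ∀ x ∈ ψ.source, DifferentiableAt ℝ ψ x := fun x hx =>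
    (hψ.contDiffOn.contDiffAt (ψ.open_source.mem_nhds hx)).differentiableAt (by simp)
  have hhA : ∀ i x, h i (SymplecticGerm.linearPart ψ x) = h i x := fun i x => by
    obtain ⟨k, hk⟩ := h_homog i
    exact SymplecticGerm.apply_fderiv_eq_of_homogeneous (h_smooth i).continuous hk
      (hdψ 0 hψ.zero_mem) hψ.map_zero (hψ_pres.mono fun x hx => hx i) x
  refine ⟨⟨hA.isSymplectomorphism, hhA⟩, fun h_indep => ?_, fun X hX _ =>
    SymplecticGerm.exists_unique_normalizedHamiltonian hX.hamiltonian⟩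
  set A := SymplecticGerm.linearPart ψ
  have h0t : (0 : SymplecticGerm.PhaseSpace n) ∈ ψ.target := by
    simpa [hψ.map_zero] using ψ.map_source hψ.zero_mem
  have hsymm0 : ψ.symm 0 = 0 := by
    simpa [hψ.map_zero] using ψ.left_inv hψ.zero_mem
  have htarget : ψ.target ∈ 𝓝 0 := ψ.open_target.mem_nhds h0t
  have hdsymm : ∀ y ∈ ψ.target, DifferentiableAt ℝ ψ.symm y := fun y hy =>
    (hψ.contDiffOn_symm.contDiffAt (ψ.open_target.mem_nhds hy)).differentiableAt (by simp)
  have hinv : ∀ y ∈ ψ.target, ∀ v, fderiv ℝ ψ (ψ.symm y) (fderiv ℝ ψ.symm y v) = v := by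
    intro y hy v
    have h1 := (hdψ _ (ψ.map_target hy)).hasFDerivAt.comp y (hdsymm y hy).hasFDerivAt
    have h2 : (ψ ∘ ψ.symm) =ᶠ[𝓝 y] id := by
      filter_upwards [ψ.open_target.mem_nhds hy] with z hz using ψ.right_inv hz
    exact DFunLike.congr_fun (h1.unique ((hasFDerivAt_id y).congr_of_eventuallyEq h2)) v
  set χ₀ : SymplecticGerm.PhaseSpace n → SymplecticGerm.PhaseSpace n := fun y => A (ψ.symm y)
  set θ₀ : SymplecticGerm.PhaseSpace n → SymplecticGerm.PhaseSpace n :=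
    fun y => ψ (hA.equiv.symm y)
  have hDχ₀ : ∀ y ∈ ψ.target, fderiv ℝ χ₀ y = A.comp (fderiv ℝ ψ.symm y) := fun y hy =>
    (A.hasFDerivAt.comp y (hdsymm y hy).hasFDerivAt).fderiv
  have hχ₀0 : χ₀ 0 = 0 := by simp [χ₀, hsymm0]
  have hθ₀0 : θ₀ 0 = 0 := by simp [θ₀, hψ.map_zero]
  have hsource : hA.equiv.symm ⁻¹' ψ.source ∈ 𝓝 0 :=
    hA.equiv.symm.continuous.continuousAt.preimage_mem_nhds
      (by simpa using ψ.open_source.mem_nhds hψ.zero_mem)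
  have hχ₀s : ContDiffOn ℝ ∞ χ₀ ψ.target := A.contDiff.comp_contDiffOn hψ.contDiffOn_symm
  have hθ₀s : ContDiffOn ℝ ∞ θ₀ (hA.equiv.symm ⁻¹' ψ.source) :=
    hψ.contDiffOn.comp hA.equiv.symm.contDiff.contDiffOn fun _ hx => hx
  -- Global smooth representatives replace the two mutually inverse germs.
  obtain ⟨χ, hχ, hχχ₀⟩ := exists_contDiff_eventuallyEq htarget hχ₀s
  obtain ⟨θ, hθ, hθθ₀⟩ := exists_contDiff_eventuallyEq hsource hθ₀s
  have hχ0 : χ 0 = 0 := hχχ₀.self_of_nhds.trans hχ₀0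
  have hθ0 : θ 0 = 0 := hθθ₀.self_of_nhds.trans hθ₀0
  have hχt : Tendsto χ (𝓝 0) (𝓝 0) := by simpa [hχ0] using hχ.continuous.tendsto 0
  have hθt : Tendsto θ (𝓝 0) (𝓝 0) := by simpa [hθ0] using hθ.continuous.tendsto 0
  have hst : Tendsto ψ.symm (𝓝 0) (𝓝 0) := by
    simpa [hsymm0] using (hdsymm 0 h0t).continuousAt.tendsto
  have hχ' : fderiv ℝ χ 0 = ContinuousLinearMap.id ℝ _ := by
    rw [hχχ₀.fderiv_eq, hDχ₀ 0 h0t]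
    ext1 v
    have h1 := hinv 0 h0t v
    rw [hsymm0] at h1
    exact h1
  have hl : ∀ᶠ x in 𝓝 0, θ (χ x) = x := by
    filter_upwards [hχχ₀, hχt.eventually hθθ₀, htarget] with x h1 h2 hx
    rw [h2, h1]
    simp only [θ₀, χ₀]
    rw [← hA.equiv_apply, ContinuousLinearEquiv.symm_apply_apply, ψ.right_inv hx]
  have hr : ∀ᶠ y in 𝓝 0, χ (θ y) = y := by
    filter_upwards [hθθ₀, hθt.eventually hχχ₀, hsource] with y h1 h2 hy
    rw [h2, h1]
    simp only [θ₀, χ₀]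
    rw [ψ.left_inv hy, ← hA.equiv_apply, ContinuousLinearEquiv.apply_symm_apply]
  have hω : ∀ᶠ x in 𝓝 0, SymplecticGerm.PreservesOmega (fderiv ℝ χ x) := by
    filter_upwards [hχχ₀.eventually_nhds, htarget] with x h1 hx u v
    rw [EventuallyEq.fderiv_eq h1, hDχ₀ x hx, ContinuousLinearMap.comp_apply,
      ContinuousLinearMap.comp_apply, hA, ← hψ.preserves _ (ψ.map_target hx), hinv x hx, hinv x hx]
  have hh : ∀ᶠ x in 𝓝 0, ∀ i, h i (χ x) = h i x := by
    filter_upwards [hχχ₀, hst.eventually hψ_pres, htarget] with x h1 h2 hx i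
    rw [h1]
    simp only [χ₀]
    rw [hhA, ← h2 i, ψ.right_inv hx]
  -- A set of full measure is dense, which is all the independence needed.
  obtain ⟨X, hX, hXχ⟩ := SymplecticGerm.exists_isTimeOneMap h_smooth h_comm h_homog
    (Measure.dense_of_ae h_indep) hχ hθ hχ0 hχ' hl hr hω hh
  exact ⟨X, hX, hXχ.congr hχχ₀⟩
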